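/- Let $\Phi(t)=e^{|t|}-|t|-1$ and $\Psi(t)=(1+|t|)\log(1+|t|)-|t|$, and let $\Phi^{-1},\Psi^{-1}:[0,\infty)\to[0,\infty)$ denote the inverses of their restrictions to $[0,\infty)$. Let $f:\mathbb R\to\mathbb R$ be $2\pi$-periodic and Lebesgue measurable with $f\in L^\Psi$, i.e. $\int_{-\pi}^{\pi}\Psi(|f(t)|)\,dt<\infty$. For $x\in\mathbb R$ and $\delta>0$ put $\varphi_x(t)=f(x+t)+f(x-t)-2f(x)$ and $$w_xf(\delta)_\Psi=\Psi^{-1}\Big\{\frac1\delta\int_0^\delta\Psi(|\varphi_x(t)|)\,dt\Big\},$$ and call $x$ an $L^\Psi$-point of $f$ if $\lim_{n\to\infty}w_xf\big(\tfrac{\pi}{n+1}\big)_\Psi=0$. Let $S_\nu f$ be the $\nu$-th partial sum of the trigonometric Fourier series of $f$, and $$H_n^\Phi f(x)=\Phi^{-1}\Big\{\frac1{n+1}\sum_{\nu=0}^n\Phi\big(|S_\nu f(x)-f(x)|\big)\Big\}.$$ Then almost every $x\in\mathbb R$ is an $L^\Psi$-point of $f$. At every $L^\Psi$-point $x$ of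 $f$, and hence for almost every $x$, $$\sum_{k=0}^{n}\frac{\Psi'\big(\frac1{k+1}\big)}{(k+1)^{1/2}}\,\Psi\Big(w_xf\Big(\frac{\pi(k+1)}{n+1}\Big)_\Psi\Big)+(n+1)\,\Psi\Big(\frac1{n+1}\Big)\Psi\big(w_xf(\pi)_\Psi\big)\longrightarrow0\qquad(n\to\infty),$$ and $$H_n^\Phi f(x)\longrightarrow0\qquad(n\to\infty).$$ -/

import Mathlib

open Real Filter Topology MeasureTheory

noncomputable section

namespace StrongApprox

/-- The N-function `Φ(t) = e^{|t|} - |t| - 1`. -/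
def expPhi (t : ℝ) : ℝ := Real.exp |t| - |t| - 1

/-- The N-function `Ψ(t) = (1 + |t|) log (1 + |t|) - |t|`, complementary to `expPhi`. -/
def logPsi (t : ℝ) : ℝ := (1 + |t|) * Real.log (1 + |t|) - |t|

/-- The inverse on `[0, ∞)` of an N-function `Θ`: an N-function maps `[0, ∞)` bijectively onto
`[0, ∞)`, so for `y ≥ 0` this is the unique `u ≥ 0` with `Θ u = y`. -/
def nInv (Θ : ℝ → ℝ) (y : ℝ) : ℝ := Function.invFunOn Θ (Set.Ici 0) y

/-- The Orlicz class `L^Ψ`: the `2π`-periodic, real-valued, Lebesgue measurable functions `f` with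
`∫_{[-π, π]} Ψ(|f|) < ∞`. -/
structure MemLPsi (Ψ f : ℝ → ℝ) : Prop where
  periodic : Function.Periodic f (2 * π)
  aemeasurable : AEMeasurable f volume
  integrableOn : IntegrableOn (fun t => Ψ |f t|) (Set.Icc (-π) π) volume

/-- The Fourier cosine coefficient `a_k(f)`. -/
def cosCoeff (f : ℝ → ℝ) (k : ℕ) : ℝ := (1 / π) * ∫ t in (-π)..π, f t * Real.cos (k * t)

/-- The Fourier sine coefficient `b_k(f)`. -/
def sinCoeff (f : ℝ → ℝ) (k : ℕ) : ℝ := (1 / π) * ∫ t in (-π)..π, f t * Real.sin (k * t)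

/-- The partial sum `S_ν f(x) = a_0/2 + ∑_{k=1}^ν (a_k cos kx + b_k sin kx)`. -/
def partialSum (f : ℝ → ℝ) (ν : ℕ) (x : ℝ) : ℝ :=
  cosCoeff f 0 / 2 +
    ∑ k ∈ Finset.Icc 1 ν, (cosCoeff f k * Real.cos (k * x) + sinCoeff f k * Real.sin (k * x))

/-- The strong mean `H_n^Φ f(x) = Φ⁻¹ ((n+1)⁻¹ ∑_{ν=0}^n Φ(|S_ν f(x) - f(x)|))`. -/
def strongMean (Φ f : ℝ → ℝ) (n : ℕ) (x : ℝ) : ℝ :=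
  nInv Φ ((1 / ((n : ℝ) + 1)) * ∑ ν ∈ Finset.range (n + 1), Φ |partialSum f ν x - f x|)

/-- `φ_x(t) = f(x+t) + f(x-t) - 2 f(x)`. -/
def symmDiff₂ (f : ℝ → ℝ) (x t : ℝ) : ℝ := f (x + t) + f (x - t) - 2 * f x

/-- The pointwise modulus `w_x f(δ)_Ψ = Ψ⁻¹ (δ⁻¹ ∫_0^δ Ψ(|φ_x(t)|) dt)`. -/
def pointModulus (Ψ f : ℝ → ℝ) (x δ : ℝ) : ℝ :=
  nInv Ψ ((1 / δ) * ∫ t in (0 : ℝ)..δ, Ψ |symmDiff₂ f x t|)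

/-- `x` is an `L^Ψ`-point of `f`: `w_x f(π/(n+1))_Ψ → 0` as `n → ∞`. -/
def IsLPsiPoint (Ψ f : ℝ → ℝ) (x : ℝ) : Prop :=
  Tendsto (fun n : ℕ => pointModulus Ψ f x (π / ((n : ℝ) + 1))) atTop (𝓝 0)

/-- The characteristic
`∑_{k=0}^n Ψ'(1/(k+1)) (k+1)^{-1/2} Ψ(w_x f(π(k+1)/(n+1))_Ψ) + (n+1) Ψ(1/(n+1)) Ψ(w_x f(π)_Ψ)`. -/
def characteristic (Ψ f : ℝ → ℝ) (n : ℕ) (x : ℝ) : ℝ :=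
  (∑ k ∈ Finset.range (n + 1),
      deriv Ψ (1 / ((k : ℝ) + 1)) / Real.sqrt ((k : ℝ) + 1) *
        Ψ (pointModulus Ψ f x (π * ((k : ℝ) + 1) / ((n : ℝ) + 1)))) +
    ((n : ℝ) + 1) * Ψ (1 / ((n : ℝ) + 1)) * Ψ (pointModulus Ψ f x π)

end StrongApprox

end

/-! Strong means. With D_ν the Dirichlet kernel, S_ν f(x) - f(x) = π⁻¹ ∫_0^π φ_x D_ν. At an
L^Ψ-point, ∫_0^u Ψ(|φ_x|) ≤ τ²u for all u up to some δ; cut φ_x at δ. The far part of the integral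
tends to 0 by Riemann–Lebesgue, hence so do its Φ-means. The work lies in the near part, which
satisfies the bound τ²u for every u ≥ 0 (`sum_expPhi_integral_le`).

Divide [0, π] into N intervals of length π/N. Let m_k be the mean of |φ| over the k-th one, a_k =
m_k/(k+1), and p_kν its share of ∫ φ D_ν. Jensen gives ∑_{k<K} Ψ(m_k) ≤ τ²K; the size of D_ν gives
|p_kν| ≤ C a_k; a large sieve gives ∑_ν (∑_{k∈E} p_kν)² ≤ C N ∑_E a_k². Because Ψ(m) grows like m
log m, ∑ a_k^{1+s} ≤ 520τ/s for 0 < s ≤ 1 (`sum_rpow_div_le`), and this 1/s rate is what exponential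
integrability requires. To count the ν with |∑_k p_kν| > j+1, take s proportional to τ/(j+1): the
intervals with a_k > e^{-1/s} contribute at most (j+1)/2, and the remaining ones have square sum O(j
e^{-1/s}). By Chebyshev the proportion of such ν decays like e^{-cj/τ}, which beats e^j when τ is
small (`sum_expPhi_le`).

The characteristic tends to 0 by dominated convergence, its weights being at most (k+1)^{-3/2}.
Almost every x is an L^Ψ-point by Lebesgue differentiation of Ψ(|f - r|) for all rational r,
choosing r close to f(x). -/

namespace StrongApprox

/-! ### The complementary Young functions Φ and Ψ. -/

theorem logPsi_of_nonneg {x : ℝ} (hx : 0 ≤ x) :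
    logPsi x = (1 + x) * Real.log (1 + x) - x := by
  rw [logPsi, abs_of_nonneg hx]

theorem expPhi_of_nonneg {x : ℝ} (hx : 0 ≤ x) : expPhi x = Real.exp x - x - 1 := by
  rw [expPhi, abs_of_nonneg hx]

theorem logPsi_abs (x : ℝ) : logPsi |x| = logPsi x := by simp [logPsi]

theorem continuous_logPsi : Continuous logPsi := by
  unfold logPsi
  have h : ∀ x : ℝ, 1 + |x| ≠ 0 := fun x => by positivity
  fun_prop (disch := exact h _)

theorem continuous_expPhi : Continuous expPhi := by
  unfold expPhi
  fun_prop

@[simp] theorem logPsi_zero : logPsi 0 = 0 := by simp [logPsi]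

@[simp] theorem expPhi_zero : expPhi 0 = 0 := by simp [expPhi]

/-- Young's inequality, from e^z ≥ 1 + z at z = t - log(1+m). Equality at t = log(1+m)
(`logPsi_eq_young`) exhibits Ψ as a supremum of affine functions; monotonicity, Jensen and the
growth bounds below all come from choosing t. -/
theorem young_mul_le {t m : ℝ} (ht : 0 ≤ t) (hm : 0 ≤ m) :
    t * m ≤ logPsi m + expPhi t := by
  rw [logPsi_of_nonneg hm, expPhi_of_nonneg ht]
  have h1 : 0 < 1 + m := by linarith
  set y := Real.log (1 + m) with hy
  have hey : Real.exp y = 1 + m := Real.exp_log h1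
  have h2 : (1 + m) * (t - y + 1) ≤ (1 + m) * Real.exp (t - y) :=
    mul_le_mul_of_nonneg_left (Real.add_one_le_exp _) h1.le
  have h3 : (1 + m) * Real.exp (t - y) = Real.exp t := by
    rw [← hey, ← Real.exp_add]; ring_nf
  nlinarith

theorem logPsi_eq_young {m : ℝ} (hm : 0 ≤ m) :
    logPsi m = Real.log (1 + m) * m - expPhi (Real.log (1 + m)) := by
  have h1 : 0 < 1 + m := by linarith
  rw [logPsi_of_nonneg hm, expPhi_of_nonneg (Real.log_nonneg (by linarith)), Real.exp_log h1]
  ring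

theorem expPhi_nonneg (x : ℝ) : 0 ≤ expPhi x := by
  have := Real.add_one_le_exp |x|
  unfold expPhi; linarith

theorem logPsi_nonneg (x : ℝ) : 0 ≤ logPsi x := by
  have := young_mul_le (le_refl 0) (abs_nonneg x)
  rw [logPsi_abs] at this
  simpa using this

theorem logPsi_mono {x y : ℝ} (hx : 0 ≤ x) (hxy : x ≤ y) : logPsi x ≤ logPsi y := by
  have h0 : 0 ≤ Real.log (1 + x) := Real.log_nonneg (by linarith)
  have h1 := young_mul_le h0 (hx.trans hxy)
  rw [logPsi_eq_young hx]
  nlinarith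

theorem expPhi_mono {x y : ℝ} (hx : 0 ≤ x) (hxy : x ≤ y) : expPhi x ≤ expPhi y := by
  rw [expPhi_of_nonneg hx, expPhi_of_nonneg (hx.trans hxy)]
  have h := Real.add_one_le_exp (y - x)
  have h2 : Real.exp y = Real.exp x * Real.exp (y - x) := by rw [← Real.exp_add]; ring_nf
  have h3 := Real.one_le_exp hx
  nlinarith

theorem logPsi_le_sq {x : ℝ} (hx : 0 ≤ x) : logPsi x ≤ x ^ 2 := by
  rw [logPsi_of_nonneg hx]
  have := Real.log_le_sub_one_of_pos (show 0 < 1 + x by linarith)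
  nlinarith

theorem sq_div_two_le_expPhi {x : ℝ} (hx : 0 ≤ x) : x ^ 2 / 2 ≤ expPhi x := by
  rw [expPhi_of_nonneg hx]
  have := Real.quadratic_le_exp_of_nonneg hx
  linarith

theorem expPhi_le_sq {x : ℝ} (hx : 0 ≤ x) (hx1 : x ≤ 1) : expPhi x ≤ x ^ 2 := by
  rw [expPhi_of_nonneg hx]
  have := Real.abs_exp_sub_one_sub_id_le (x := x) (by rw [abs_of_nonneg hx]; exact hx1)
  have := le_abs_self (Real.exp x - 1 - x)
  linarith

/-- Young's inequality at half the optimal slope, t = log(1+m)/2; with w = e^t = √(1+m), everything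
reduces to w - 1 ≤ tw. -/
theorem mul_log_le_logPsi {m : ℝ} (hm : 0 ≤ m) : m * Real.log (1 + m) / 4 ≤ logPsi m := by
  have h1 : (0 : ℝ) < 1 + m := by linarith
  set t := Real.log (1 + m) / 2 with ht
  have ht0 : 0 ≤ t := by have := Real.log_nonneg (show 1 ≤ 1 + m by linarith); positivity
  set w := Real.exp t with hw
  have hw1 : 1 ≤ w := Real.one_le_exp ht0
  have hw2 : w * w = 1 + m := by
    rw [hw, ← Real.exp_add, ht, add_halves, Real.exp_log h1]
  have hy := young_mul_le ht0 hm
  rw [expPhi_of_nonneg ht0] at hy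
  have h2 : w - 1 ≤ t * w := by
    have := Real.add_one_le_exp (-t)
    have h3 : w * Real.exp (-t) = 1 := by rw [hw, ← Real.exp_add]; simp
    nlinarith
  have h4 : m * Real.log (1 + m) / 4 = t * (w - 1) * (w + 1) / 2 := by
    have : Real.log (1 + m) = 2 * t := by rw [ht]; ring
    rw [this]
    linear_combination (-(t / 2)) * hw2
  have h5 : m * t = t * (w * w) - t := by linear_combination (-t) * hw2
  rw [h4]
  nlinarith [mul_nonneg ht0 (sub_nonneg.2 hw1), mul_nonneg (mul_nonneg ht0 (sub_nonneg.2 hw1)) (sub_nonneg.2 hw1)]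

/-- Substitute for the triangle inequality. Using Young for a and b at a quarter of the slope
optimal for a + b reduces the claim to 8Φ(t) ≤ Φ(4t). -/
theorem logPsi_add_le {a b : ℝ} (ha : 0 ≤ a) (hb : 0 ≤ b) :
    logPsi (a + b) ≤ 4 * logPsi a + 4 * logPsi b := by
  set t := Real.log (1 + (a + b)) / 4 with ht
  have h1 : 0 < 1 + (a + b) := by linarith
  have h4 : Real.log (1 + (a + b)) = 4 * t := by rw [ht]; ring
  have ht0 : 0 ≤ t := by
    have := Real.log_nonneg (show 1 ≤ 1 + (a + b) by linarith)
    positivity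
  set w := Real.exp t with hw
  have he : Real.exp (4 * t) = w ^ 4 := by rw [hw, ← Real.exp_nat_mul]; norm_num
  have hw1 : 1 ≤ w := Real.one_le_exp ht0
  have hya := young_mul_le ht0 ha
  have hyb := young_mul_le ht0 hb
  rw [logPsi_eq_young (by positivity), h4]
  rw [expPhi_of_nonneg ht0] at hya hyb
  rw [expPhi_of_nonneg (by positivity), he]
  have h3 : w * (w ^ 4 - 8 * w + 7 + 4 * t) ≥ 0 := by
    have h5 : w - 1 ≤ t * w := by
      have := Real.add_one_le_exp (-t)
      have h3 : w * Real.exp (-t) = 1 := by rw [hw, ← Real.exp_add]; simp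
      nlinarith
    -- The product is w⁵ - 8w² + 11w - 4, which is what remains of the target once 4tw is replaced
    -- by its lower bound 4(w - 1).
    have h6 : 0 ≤ (w - 1) ^ 2 * (w ^ 3 + 2 * w ^ 2 + 3 * w - 4) :=
      mul_nonneg (sq_nonneg _) (by nlinarith [pow_le_pow_left₀ zero_le_one hw1 3])
    nlinarith
  have h7 : 0 ≤ w ^ 4 - 8 * w + 7 + 4 * t := nonneg_of_mul_nonneg_right h3 (by linarith)
  linarith

theorem logPsi_abs_add_le (a b : ℝ) : logPsi |a + b| ≤ 4 * logPsi |a| + 4 * logPsi |b| :=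
  (logPsi_mono (abs_nonneg _) (abs_add_le a b)).trans
    (logPsi_add_le (abs_nonneg a) (abs_nonneg b))

theorem expPhi_add_le {a b : ℝ} (ha : 0 ≤ a) (hb : 0 ≤ b) :
    expPhi (a + b) ≤ expPhi (2 * a) / 2 + expPhi (2 * b) / 2 := by
  rw [expPhi_of_nonneg (by positivity), expPhi_of_nonneg (by positivity),
    expPhi_of_nonneg (by positivity)]
  have e1 : Real.exp (2 * a) = Real.exp a * Real.exp a := by rw [← Real.exp_add]; ring_nf
  have e2 : Real.exp (2 * b) = Real.exp b * Real.exp b := by rw [← Real.exp_add]; ring_nf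
  rw [e1, e2, Real.exp_add]
  nlinarith [sq_nonneg (Real.exp a - Real.exp b)]

/-! ### Inverses on the half-line. -/

theorem nInv_spec {Θ : ℝ → ℝ} (hc : Continuous Θ) (h0 : Θ 0 = 0)
    (hub : ∀ y : ℝ, 0 ≤ y → ∃ u, 0 ≤ u ∧ y ≤ Θ u) {y : ℝ} (hy : 0 ≤ y) :
    0 ≤ nInv Θ y ∧ Θ (nInv Θ y) = y := by
  obtain ⟨u, hu, hyu⟩ := hub y hy
  have : y ∈ Θ '' Set.Icc 0 u :=
    intermediate_value_Icc hu hc.continuousOn ⟨by rw [h0]; exact hy, hyu⟩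
  have h : ∃ a ∈ Set.Ici (0 : ℝ), Θ a = y := by
    obtain ⟨a, ha, hya⟩ := this
    exact ⟨a, ha.1, hya⟩
  exact ⟨Function.invFunOn_mem h, Function.invFunOn_eq h⟩

theorem nInv_expPhi {y : ℝ} (hy : 0 ≤ y) :
    0 ≤ nInv expPhi y ∧ expPhi (nInv expPhi y) = y := by
  refine nInv_spec continuous_expPhi expPhi_zero (fun y hy => ⟨y + 2, by linarith, ?_⟩) hy
  have := sq_div_two_le_expPhi (show 0 ≤ y + 2 by linarith)
  nlinarith

theorem nInv_logPsi {y : ℝ} (hy : 0 ≤ y) :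
    0 ≤ nInv logPsi y ∧ logPsi (nInv logPsi y) = y := by
  refine nInv_spec continuous_logPsi logPsi_zero (fun y hy => ?_) hy
  refine ⟨y + expPhi 1, by have := expPhi_nonneg 1; linarith, ?_⟩
  have h1 := expPhi_nonneg 1
  have h2 := young_mul_le (show (0 : ℝ) ≤ 1 by norm_num)
    (show 0 ≤ y + expPhi 1 by linarith)
  linarith

theorem tendsto_nInv_expPhi {u : ℕ → ℝ} (hu : ∀ n, 0 ≤ u n)
    (h : Tendsto u atTop (𝓝 0)) : Tendsto (fun n => nInv expPhi (u n)) atTop (𝓝 0) := by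
  have h2 : Tendsto (fun n => Real.sqrt (2 * u n)) atTop (𝓝 0) := by
    have := (h.const_mul 2).sqrt
    rwa [mul_zero, Real.sqrt_zero] at this
  refine squeeze_zero (fun n => (nInv_expPhi (hu n)).1) (fun n => ?_) h2
  obtain ⟨h3, h4⟩ := nInv_expPhi (hu n)
  have h5 := sq_div_two_le_expPhi h3
  rw [h4] at h5
  exact Real.le_sqrt_of_sq_le (by linarith)

theorem deriv_logPsi {x : ℝ} (hx : 0 < x) : deriv logPsi x = Real.log (1 + x) := by
  have h1 : 1 + x ≠ 0 := by positivity
  have h : logPsi =ᶠ[𝓝 x] fun y => (1 + y) * Real.log (1 + y) - y := by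
    filter_upwards [lt_mem_nhds hx] with y hy using logPsi_of_nonneg hy.le
  rw [h.deriv_eq]
  have hd : HasDerivAt (fun y : ℝ => 1 + y) 1 x := (hasDerivAt_id x).const_add 1
  have := (hd.mul (hd.log h1)).sub (hasDerivAt_id x)
  refine this.deriv.trans ?_
  field_simp
  ring

/-- Young's inequality with Φ(t) ≤ t². Averaged against ∑ Ψ(m_k) ≤ τ²K at t = τ, it makes m_k of
size τ on average. -/
theorem le_add_logPsi_div {t m : ℝ} (ht : 0 < t) (ht1 : t ≤ 1) (hm : 0 ≤ m) :
    m ≤ t + logPsi m / t := by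
  have h := young_mul_le ht.le hm
  have h2 := expPhi_le_sq ht.le ht1
  have : m ≤ (t ^ 2 + logPsi m) / t := by rw [le_div_iff₀ ht]; linarith
  calc m ≤ _ := this
    _ = _ := by field_simp

/-! ### Abel summation and weights with sums O(1/s). -/

theorem sum_mul_le_of_antitone {ψ v : ℕ → ℝ} {ε : ℝ}
    (h : ∀ K : ℕ, ∑ k ∈ Finset.range K, ψ k ≤ ε * K) (hv : Antitone v) (hv0 : ∀ k, 0 ≤ v k)
    (N : ℕ) : ∑ k ∈ Finset.range N, ψ k * v k ≤ ε * ∑ k ∈ Finset.range N, v k := by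
  -- Summation by parts as an induction: the slack εN - ∑ψ, weighted by the current v, is carried
  -- along and only loses weight as v decreases.
  have key : ∑ k ∈ Finset.range N, ψ k * v k + (ε * N - ∑ k ∈ Finset.range N, ψ k) * v N
      ≤ ε * ∑ k ∈ Finset.range N, v k := by
    induction N with
    | zero => simp
    | succ n ih =>
      have h1 := h (n + 1)
      have h2 := hv (Nat.le_succ n)
      rw [Finset.sum_range_succ] at h1
      simp only [Finset.sum_range_succ]
      push_cast at h1 ⊢
      have h3 := mul_le_mul_of_nonneg_left h2 (sub_nonneg.2 h1)
      rw [Nat.succ_eq_add_one] at h3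
      linarith
  have := mul_nonneg (sub_nonneg.2 (h N)) (hv0 N)
  linarith

/-- Comparison of s∫_x^y u^{-1-s} du with its smallest integrand, proved through e^z ≥ 1 + z. It
supplies the telescoping in both weight sums below. -/
theorem mul_rpow_le_rpow_sub_rpow {x y s : ℝ} (hx : 0 < x) (hxy : x ≤ y) (hs : 0 < s) :
    s * (y - x) * y ^ (-(1 + s)) ≤ x ^ (-s) - y ^ (-s) := by
  have hy : 0 < y := hx.trans_le hxy
  have h1 : y ^ (-(1 + s)) = y ^ (-s) / y := by
    rw [show -(1 + s) = -s - 1 by ring, Real.rpow_sub_one hy.ne']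
  have h2 : x ^ (-s) = y ^ (-s) * (x / y) ^ (-s) := by
    rw [← Real.mul_rpow hy.le (by positivity), mul_div_cancel₀ _ hy.ne']
  have h3 : 1 + s * (1 - x / y) ≤ (x / y) ^ (-s) := by
    have hl := Real.log_le_sub_one_of_pos (div_pos hx hy)
    have he := Real.add_one_le_exp (Real.log (x / y) * (-s))
    rw [Real.rpow_def_of_pos (div_pos hx hy)]
    nlinarith
  have h4 : 0 < y ^ (-s) := Real.rpow_pos_of_pos hy _
  rw [h1, h2]
  have h5 : s * (y - x) * (y ^ (-s) / y) = y ^ (-s) * (s * (1 - x / y)) := by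
    field_simp
  rw [h5]
  nlinarith

theorem sum_rpow_le {s : ℝ} (hs : 0 < s) (N : ℕ) :
    ∑ k ∈ Finset.range N, ((k : ℝ) + 1) ^ (-(1 + s)) ≤ 1 + 1 / s := by
  cases N with
  | zero => simp; positivity
  | succ n =>
    have key : s * ∑ k ∈ Finset.range (n + 1), ((k : ℝ) + 1) ^ (-(1 + s))
        ≤ s + 1 - ((n : ℝ) + 1) ^ (-s) := by
      induction n with
      | zero => simp
      | succ n ih =>
        rw [Finset.sum_range_succ, mul_add]
        have := mul_rpow_le_rpow_sub_rpow (x := (n : ℝ) + 1) (y := (n : ℝ) + 1 + 1)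
          (by positivity) (by linarith) hs
        push_cast at ih ⊢
        linarith
    have h0 : 0 ≤ ((n : ℝ) + 1) ^ (-s) := by positivity
    have h1 : 1 + 1 / s = (s + 1) / s := by field_simp
    rw [h1, le_div_iff₀ hs]
    linarith

/-- The weight `1 / (K log^{1+s} (K+1))`, `K = k + 1`. -/
noncomputable def logWeight (s : ℝ) (k : ℕ) : ℝ :=
  ((k : ℝ) + 1)⁻¹ * Real.log ((k : ℝ) + 2) ^ (-(1 + s))

theorem half_le_log_add_two (k : ℕ) : 1 / 2 ≤ Real.log ((k : ℝ) + 2) := by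
  have h1 := Real.log_two_gt_d9
  have h2 : Real.log 2 ≤ Real.log ((k : ℝ) + 2) :=
    Real.log_le_log (by norm_num) (by have := Nat.cast_nonneg (α := ℝ) k; linarith)
  linarith

theorem logWeight_nonneg (s : ℝ) (k : ℕ) : 0 ≤ logWeight s k := by
  have := half_le_log_add_two k
  unfold logWeight
  exact mul_nonneg (by positivity) (Real.rpow_nonneg (by linarith) _)

theorem logWeight_antitone {s : ℝ} (hs : 0 < s) : Antitone (logWeight s) := by
  intro i j hij
  have hij' : (i : ℝ) ≤ j := by exact_mod_cast hij
  have := half_le_log_add_two i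
  have := half_le_log_add_two j
  unfold logWeight
  refine mul_le_mul ?_ ?_ (Real.rpow_nonneg (by linarith) _) (by positivity)
  · gcongr
  · refine Real.rpow_le_rpow_of_nonpos (by linarith) ?_ (by linarith)
    exact Real.log_le_log (by positivity) (by linarith)

theorem sum_logWeight_le {s : ℝ} (hs : 0 < s) (hs1 : s ≤ 1) (N : ℕ) :
    ∑ k ∈ Finset.range N, logWeight s k ≤ 8 / s := by
  cases N with
  | zero => simp; positivity
  | succ n =>
    have hl := Real.log_two_gt_d9
    have hpow : ∀ r : ℝ, 0 ≤ r → r ≤ 2 → Real.log 2 ^ (-r) ≤ 4 := by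
      intro r hr0 hr
      have h1 : Real.log 2 ^ (-r) ≤ (1 / 2 : ℝ) ^ (-r) :=
        Real.rpow_le_rpow_of_nonpos (by norm_num) (by linarith) (by linarith)
      have h2 : (1 / 2 : ℝ) ^ (-r) ≤ (1 / 2 : ℝ) ^ (-2 : ℝ) :=
        Real.rpow_le_rpow_of_exponent_ge (by norm_num) (by norm_num) (by linarith)
      have h3 : (1 / 2 : ℝ) ^ (-2 : ℝ) = 4 := by
        rw [Real.rpow_neg (by norm_num)]; norm_num
      linarith
    have hpow1 : Real.log 2 ^ (-s) ≤ 2 := by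
      have h1 : Real.log 2 ^ (-s) ≤ (1 / 2 : ℝ) ^ (-s) :=
        Real.rpow_le_rpow_of_nonpos (by norm_num) (by linarith) (by linarith)
      have h2 : (1 / 2 : ℝ) ^ (-s) ≤ (1 / 2 : ℝ) ^ (-1 : ℝ) :=
        Real.rpow_le_rpow_of_exponent_ge (by norm_num) (by norm_num) (by linarith)
      have h3 : (1 / 2 : ℝ) ^ (-1 : ℝ) = 2 := by
        rw [Real.rpow_neg (by norm_num)]; norm_num
      linarith
    -- The telescoping term carries a factor 2 because 1/(n+2) ≤ 2/(n+3) is used to match each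
    -- weight with the increment of the logarithm ending at n+3.
    have key : s * ∑ k ∈ Finset.range (n + 1), logWeight s k
        ≤ 4 * s + 4 - 2 * Real.log ((n : ℝ) + 2) ^ (-s) := by
      induction n with
      | zero =>
        have h1 := hpow (1 + s) (by linarith) (by linarith)
        simp [logWeight] at h1 ⊢
        nlinarith
      | succ n ih =>
        rw [Finset.sum_range_succ, mul_add]
        have h1 := half_le_log_add_two n
        have h1' := half_le_log_add_two (n + 1)
        have h2 : Real.log ((n : ℝ) + 2) ≤ Real.log ((n : ℝ) + 3) :=
          Real.log_le_log (by positivity) (by linarith)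
        have h3 := mul_rpow_le_rpow_sub_rpow (by linarith) h2 hs
        have h4 : ((n : ℝ) + 3)⁻¹ ≤ Real.log ((n : ℝ) + 3) - Real.log ((n : ℝ) + 2) := by
          have h5 := Real.log_le_sub_one_of_pos
            (show 0 < ((n : ℝ) + 2) / ((n : ℝ) + 3) by positivity)
          rw [Real.log_div (by positivity) (by positivity)] at h5
          have h6 : ((n : ℝ) + 2) / ((n : ℝ) + 3) - 1 = -((n : ℝ) + 3)⁻¹ := by
            field_simp; ring
          linarith
        have h5 : ((n : ℝ) + 2)⁻¹ ≤ 2 * ((n : ℝ) + 3)⁻¹ := by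
          rw [← div_eq_mul_inv, inv_eq_one_div, div_le_div_iff₀ (by positivity) (by positivity)]
          have := Nat.cast_nonneg (α := ℝ) n
          linarith
        have h6 : logWeight s (n + 1) =
            ((n : ℝ) + 2)⁻¹ * Real.log ((n : ℝ) + 3) ^ (-(1 + s)) := by
          unfold logWeight; push_cast; ring_nf
        have h7 : 0 ≤ Real.log ((n : ℝ) + 3) ^ (-(1 + s)) :=
          Real.rpow_nonneg (by linarith) _
        have h8 : s * logWeight s (n + 1) ≤
            2 * (s * (Real.log ((n : ℝ) + 3) - Real.log ((n : ℝ) + 2)) *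
              Real.log ((n : ℝ) + 3) ^ (-(1 + s))) := by
          rw [h6]
          calc _ ≤ s * ((2 * (Real.log ((n : ℝ) + 3) - Real.log ((n : ℝ) + 2))) *
              Real.log ((n : ℝ) + 3) ^ (-(1 + s))) := by
                gcongr; linarith
            _ = _ := by ring
        have h9 : ((n + 1 : ℕ) : ℝ) + 2 = (n : ℝ) + 3 := by push_cast; ring
        rw [h9]
        linarith
    have h0 : 0 ≤ Real.log ((n : ℝ) + 2) ^ (-s) :=
      Real.rpow_nonneg (by linarith [half_le_log_add_two n]) _
    rw [le_div_iff₀ hs]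
    linarith

/-! ### Power sums of m_k/(k+1). -/

/-- For small m the extra factor (m/K)^s is at most K^{-s/2}, enough for a convergent sum, while m
itself is linearised by Young. -/
theorem rpow_div_le_of_le_sqrt {m τ s : ℝ} (hm : 0 ≤ m) (hτ : 0 < τ) (hτ1 : τ ≤ 1) (hs : 0 < s)
    (k : ℕ) (h : m ≤ Real.sqrt ((k : ℝ) + 1)) :
    (m / ((k : ℝ) + 1)) ^ (1 + s) ≤
      (τ + logPsi m / τ) * ((k : ℝ) + 1) ^ (-(1 + s / 2)) := by
  set K := (k : ℝ) + 1
  have hK : 0 < K := by positivity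
  rcases hm.eq_or_lt with rfl | hm0
  · rw [zero_div, Real.zero_rpow (by linarith)]
    have := logPsi_nonneg 0
    positivity
  have hmK : 0 < m / K := by positivity
  have h1 : (m / K) ^ s ≤ K ^ (-(s / 2)) := by
    have : m / K ≤ K ^ (-(1 / 2) : ℝ) := by
      rw [div_le_iff₀ hK]
      calc m ≤ Real.sqrt K := h
        _ = K ^ (-(1 / 2) : ℝ) * K := by
          rw [Real.sqrt_eq_rpow, ← Real.rpow_add_one hK.ne']; norm_num
    calc (m / K) ^ s ≤ (K ^ (-(1 / 2) : ℝ)) ^ s := Real.rpow_le_rpow hmK.le this hs.le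
      _ = _ := by rw [← Real.rpow_mul hK.le]; ring_nf
  have h2 : (m / K) ^ (1 + s) = m / K * (m / K) ^ s := Real.rpow_one_add' hmK.le (by linarith)
  have h3 : K ^ (-(1 + s / 2)) = K ^ (-(s / 2)) / K := by
    rw [show -(1 + s / 2) = -(s / 2) - 1 by ring, Real.rpow_sub_one hK.ne']
  rw [h2, h3]
  calc m / K * (m / K) ^ s ≤ m / K * K ^ (-(s / 2)) := by gcongr
    _ = m * (K ^ (-(s / 2)) / K) := by ring
    _ ≤ _ := by
      gcongr
      exact le_add_logPsi_div hτ hτ1 hm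

/-- For m ≥ √K, log(1+m) is at least half of log(K+1), so m ≤ 8Ψ(m)/log(K+1). One factor m/K keeps
Ψ(m); in the factor raised to s, Ψ(m) ≤ K leaves 8/log(K+1). -/
theorem rpow_div_le_of_sqrt_le {m s : ℝ} (hs : 0 < s) (hs1 : s ≤ 1)
    (k : ℕ) (h : Real.sqrt ((k : ℝ) + 1) ≤ m) (hψ : logPsi m ≤ (k : ℝ) + 1) :
    (m / ((k : ℝ) + 1)) ^ (1 + s) ≤ 64 * logPsi m * logWeight s k := by
  have hlk := half_le_log_add_two k
  set l := Real.log ((k : ℝ) + 2) with hl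
  have hl0 : 0 < l := by linarith
  have hm0 : 0 < m := (Real.sqrt_pos.2 (by positivity)).trans_le h
  have hml : m * l ≤ 8 * logPsi m := by
    have h1 := mul_log_le_logPsi hm0.le
    have h2 : l ≤ 2 * Real.log (1 + m) := by
      rw [hl, show 2 * Real.log (1 + m) = Real.log ((1 + m) ^ 2) by simp]
      refine Real.log_le_log (by positivity) ?_
      have := Real.sq_sqrt (show 0 ≤ (k : ℝ) + 1 by positivity)
      have := Real.sqrt_nonneg ((k : ℝ) + 1)
      nlinarith
    nlinarith
  unfold logWeight
  rw [← hl]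
  set K := (k : ℝ) + 1
  have hK : 0 < K := by positivity
  have ha : m / K ≤ 8 * logPsi m * K⁻¹ * l⁻¹ := by
    rw [div_eq_mul_inv]
    have : m ≤ 8 * logPsi m * l⁻¹ := by
      rw [← div_eq_mul_inv, le_div_iff₀ hl0]; exact hml
    calc m * K⁻¹ ≤ (8 * logPsi m * l⁻¹) * K⁻¹ := by gcongr
      _ = _ := by ring
  have ha2 : m / K ≤ 8 * l⁻¹ := by
    rw [← div_eq_mul_inv, div_le_div_iff₀ hK hl0]
    linarith
  have h3 : (m / K) ^ s ≤ 8 * l ^ (-s) := by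
    calc (m / K) ^ s ≤ (8 * l⁻¹) ^ s := Real.rpow_le_rpow (by positivity) ha2 hs.le
      _ = 8 ^ s * l ^ (-s) := by
        rw [Real.mul_rpow (by norm_num) (by positivity), Real.inv_rpow hl0.le,
          Real.rpow_neg hl0.le]
      _ ≤ 8 * l ^ (-s) := by
        gcongr
        calc (8 : ℝ) ^ s ≤ 8 ^ (1 : ℝ) :=
              Real.rpow_le_rpow_of_exponent_le (by norm_num) hs1
          _ = 8 := by norm_num
  have h4 : l ^ (-(1 + s)) = l ^ (-s) * l⁻¹ := by
    rw [show -(1 + s) = -s - 1 by ring, Real.rpow_sub_one hl0.ne', div_eq_mul_inv]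
  rw [Real.rpow_one_add' (by positivity) (by linarith), h4]
  have := logPsi_nonneg m
  calc m / K * (m / K) ^ s ≤ (8 * logPsi m * K⁻¹ * l⁻¹) * (8 * l ^ (-s)) := by gcongr
    _ = _ := by ring

/-- Both regimes give Ψ(m_k) times a decreasing weight of total mass O(1/s), so Abel summation
applies. The final 520 is 3 + 3 + 64·8, rounded up, using τ² ≤ τ. -/
theorem sum_rpow_div_le {m : ℕ → ℝ} (hm : ∀ k, 0 ≤ m k) {τ : ℝ} (hτ : 0 < τ) (hτ1 : τ ≤ 1)
    (h : ∀ K : ℕ, ∑ k ∈ Finset.range K, logPsi (m k) ≤ τ ^ 2 * K)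
    {s : ℝ} (hs : 0 < s) (hs1 : s ≤ 1) (N : ℕ) :
    ∑ k ∈ Finset.range N, (m k / ((k : ℝ) + 1)) ^ (1 + s) ≤ 520 * τ / s := by
  have hψ : ∀ k, logPsi (m k) ≤ (k : ℝ) + 1 := by
    intro k
    have h1 := h (k + 1)
    have h2 : logPsi (m k) ≤ ∑ j ∈ Finset.range (k + 1), logPsi (m j) :=
      Finset.single_le_sum (f := fun j => logPsi (m j)) (fun j _ => logPsi_nonneg _)
        (Finset.self_mem_range_succ k)
    push_cast at h1
    have h3 : τ ^ 2 * ((k : ℝ) + 1) ≤ 1 * ((k : ℝ) + 1) := by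
      gcongr
      exact pow_le_one₀ hτ.le hτ1
    linarith
  set v : ℕ → ℝ := fun k => ((k : ℝ) + 1) ^ (-(1 + s / 2)) with hv
  have hv0 : ∀ k, 0 ≤ v k := fun k => by positivity
  have hva : Antitone v := by
    intro i j hij
    have : (i : ℝ) ≤ j := by exact_mod_cast hij
    exact Real.rpow_le_rpow_of_nonpos (by positivity) (by linarith) (by linarith)
  have hpt : ∀ k ∈ Finset.range N, (m k / ((k : ℝ) + 1)) ^ (1 + s) ≤
      τ * v k + 1 / τ * (logPsi (m k) * v k) + 64 * (logPsi (m k) * logWeight s k) := by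
    intro k _
    have hp := logPsi_nonneg (m k)
    have hv0k := hv0 k
    have hw := logWeight_nonneg s k
    rcases le_total (m k) (Real.sqrt ((k : ℝ) + 1)) with hc | hc
    · have h1 := rpow_div_le_of_le_sqrt (hm k) hτ hτ1 hs k hc
      have h2 : 0 ≤ 64 * (logPsi (m k) * logWeight s k) := by positivity
      have h3 : (τ + logPsi (m k) / τ) * ((k : ℝ) + 1) ^ (-(1 + s / 2)) =
        τ * v k + 1 / τ * (logPsi (m k) * v k) := by simp only [hv]; ring
      linarith
    · have h1 := rpow_div_le_of_sqrt_le hs hs1 k hc (hψ k)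
      have h2 : 0 ≤ τ * v k + 1 / τ * (logPsi (m k) * v k) := by positivity
      linarith
  have hA := sum_mul_le_of_antitone h hva hv0 N
  have hB := sum_mul_le_of_antitone h (logWeight_antitone hs) (logWeight_nonneg s) N
  have hC := sum_rpow_le (show 0 < s / 2 by positivity) N
  have hD := sum_logWeight_le hs hs1 N
  have hC' : ∑ k ∈ Finset.range N, v k ≤ 3 / s := by
    refine hC.trans ?_
    rw [le_div_iff₀ hs]
    field_simp
    linarith
  calc _ ≤ ∑ k ∈ Finset.range N,
      (τ * v k + 1 / τ * (logPsi (m k) * v k) + 64 * (logPsi (m k) * logWeight s k)) :=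
        Finset.sum_le_sum hpt
    _ = τ * ∑ k ∈ Finset.range N, v k + 1 / τ * ∑ k ∈ Finset.range N, logPsi (m k) * v k
        + 64 * ∑ k ∈ Finset.range N, logPsi (m k) * logWeight s k := by
      simp only [Finset.sum_add_distrib, Finset.mul_sum]
    _ ≤ τ * (3 / s) + 1 / τ * (τ ^ 2 * (3 / s)) + 64 * (τ ^ 2 * (8 / s)) := by
      gcongr
      · exact hA.trans (by gcongr)
      · exact hB.trans (by gcongr)
    _ = (6 * τ + 512 * τ ^ 2) / s := by field_simp; ring
    _ ≤ 520 * τ / s := by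
      gcongr
      nlinarith

/-! ### From power sums to exponential means. -/

/-- A layer decomposition: if j+1 < x ≤ j+2, the single level j already pays for e^x. The q_j
majorise the indicators of x > j+1 and will be Chebyshev quotients. -/
theorem expPhi_le_sq_add_sum {x : ℝ} (hx : 0 ≤ x) {q : ℕ → ℝ} (hq : ∀ j, 0 ≤ q j)
    (hq1 : ∀ j : ℕ, (j : ℝ) + 1 < x → 1 ≤ q j) {J : ℕ} (hJ : x ≤ J) :
    expPhi x ≤ x ^ 2 + ∑ j ∈ Finset.range J, Real.exp ((j : ℝ) + 2) * q j := by
  have hsum : ∀ j : ℕ, 0 ≤ Real.exp ((j : ℝ) + 2) * q j := fun j => mul_nonneg (Real.exp_pos _).le (hq j)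
  rcases le_or_gt x 1 with h1 | h1
  · have := expPhi_le_sq hx h1
    have := Finset.sum_nonneg (s := Finset.range J) (fun j _ => hsum j)
    linarith
  · obtain ⟨j, hj⟩ : ∃ j : ℕ, ⌈x⌉₊ = j + 2 := by
      have : 1 < ⌈x⌉₊ := Nat.lt_ceil.2 (by simpa using h1)
      exact ⟨⌈x⌉₊ - 2, by omega⟩
    have h2 : x ≤ (j : ℝ) + 2 := by
      have := Nat.le_ceil x
      rw [hj] at this; push_cast at this; exact this
    have h3 : (j : ℝ) + 1 < x := by
      have : j + 1 < ⌈x⌉₊ := by omega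
      have := Nat.lt_ceil.1 this
      push_cast at this; exact this
    have h4 : j ∈ Finset.range J := by
      rw [Finset.mem_range]
      have : (j : ℝ) < J := by linarith
      exact_mod_cast this
    have h5 := Finset.single_le_sum (f := fun j : ℕ => Real.exp ((j : ℝ) + 2) * q j)
      (fun j _ => hsum j) h4
    have h6 : expPhi x ≤ Real.exp ((j : ℝ) + 2) := by
      rw [expPhi_of_nonneg hx]
      have := Real.exp_le_exp.2 h2
      linarith
    have h7 := mul_le_mul_of_nonneg_left (hq1 j h3) (Real.exp_pos ((j : ℝ) + 2)).le
    have h8 := sq_nonneg x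
    linarith

/-- Above the threshold e^{-1/s} one has a^s ≥ e⁻¹, so the power 1+s costs only a factor e compared
with the first power. -/
theorem sum_large_le {a : ℕ → ℝ} (ha : ∀ k, 0 ≤ a k) {B s : ℝ} (hs : 0 < s) {N : ℕ}
    (h : ∑ k ∈ Finset.range N, a k ^ (1 + s) ≤ B) :
    ∑ k ∈ Finset.range N with ¬ a k ≤ Real.exp (-(1 / s)), a k ≤ Real.exp 1 * B := by
  calc ∑ k ∈ Finset.range N with ¬ a k ≤ Real.exp (-(1 / s)), a k
      ≤ ∑ k ∈ Finset.range N with ¬ a k ≤ Real.exp (-(1 / s)), Real.exp 1 * a k ^ (1 + s) := by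
        refine Finset.sum_le_sum fun k hk => ?_
        have hk2 := not_le.1 (Finset.mem_filter.1 hk).2
        have hk0 : 0 < a k := (Real.exp_pos _).trans hk2
        rw [Real.rpow_one_add' hk0.le (by linarith)]
        have h1 : Real.exp (-1) ≤ a k ^ s := by
          calc Real.exp (-1) = Real.exp (-(1 / s)) ^ s := by
                rw [← Real.exp_mul]; congr 1; field_simp
            _ ≤ _ := Real.rpow_le_rpow (Real.exp_pos _).le hk2.le hs.le
        have h2 : Real.exp 1 * Real.exp (-1) = 1 := by rw [← Real.exp_add]; simp
        have h3 : 1 ≤ Real.exp 1 * a k ^ s := by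
          exact h2.symm.trans_le (by gcongr)
        calc a k = a k * 1 := (mul_one _).symm
          _ ≤ a k * (Real.exp 1 * a k ^ s) := by gcongr
          _ = _ := by ring
    _ ≤ ∑ k ∈ Finset.range N, Real.exp 1 * a k ^ (1 + s) :=
        Finset.sum_le_sum_of_subset_of_nonneg (Finset.filter_subset _ _) fun k _ _ =>
          mul_nonneg (Real.exp_pos _).le (Real.rpow_nonneg (ha k) _)
    _ ≤ _ := by rw [← Finset.mul_sum]; gcongr

/-- Below the threshold, a² = a^{1-s} a^{1+s} and a^{1-s} ≤ e·e^{-1/s}: the square sum gains an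
exponentially small factor. -/
theorem sum_small_sq_le {a : ℕ → ℝ} (ha : ∀ k, 0 ≤ a k) {B s : ℝ} (hs : 0 < s) (hs1 : s ≤ 1)
    {N : ℕ} (h : ∑ k ∈ Finset.range N, a k ^ (1 + s) ≤ B) :
    ∑ k ∈ Finset.range N with a k ≤ Real.exp (-(1 / s)), a k ^ 2 ≤
      Real.exp 1 * Real.exp (-(1 / s)) * B := by
  calc ∑ k ∈ Finset.range N with a k ≤ Real.exp (-(1 / s)), a k ^ 2
      ≤ ∑ k ∈ Finset.range N with a k ≤ Real.exp (-(1 / s)),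
          Real.exp 1 * Real.exp (-(1 / s)) * a k ^ (1 + s) := by
        refine Finset.sum_le_sum fun k hk => ?_
        have hk2 := (Finset.mem_filter.1 hk).2
        have h1 : a k ^ (1 - s) ≤ Real.exp 1 * Real.exp (-(1 / s)) := by
          calc a k ^ (1 - s) ≤ Real.exp (-(1 / s)) ^ (1 - s) :=
                Real.rpow_le_rpow (ha k) hk2 (by linarith)
            _ = _ := by
              rw [← Real.exp_mul, ← Real.exp_add]; congr 1; field_simp; ring
        have h2 : a k ^ 2 = a k ^ (1 - s) * a k ^ (1 + s) := by
          rw [← Real.rpow_add_of_nonneg (ha k) (by linarith) (by linarith), ← Real.rpow_natCast]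
          congr 1; push_cast; ring
        rw [h2]
        have := Real.rpow_nonneg (ha k) (1 + s)
        gcongr
    _ ≤ ∑ k ∈ Finset.range N, Real.exp 1 * Real.exp (-(1 / s)) * a k ^ (1 + s) :=
        Finset.sum_le_sum_of_subset_of_nonneg (Finset.filter_subset _ _) fun k _ _ =>
          mul_nonneg (by positivity) (Real.rpow_nonneg (ha k) _)
    _ ≤ _ := by rw [← Finset.mul_sum]; gcongr

theorem exp_one_sub_inv_le {κ : ℝ} (hκ : 0 < κ) : Real.exp (1 - 1 / κ) ≤ Real.exp 1 * κ := by
  rw [sub_eq_add_neg, Real.exp_add, Real.exp_neg]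
  gcongr
  rw [inv_le_comm₀ (Real.exp_pos _) hκ]
  have := Real.add_one_le_exp (1 / κ)
  rw [one_div] at this ⊢
  linarith

theorem sum_expPhi_le {m : ℕ → ℝ} (hm : ∀ k, 0 ≤ m k) {τ C : ℝ} (hτ : 0 < τ) (hC : 1 ≤ C)
    (hsmall : 3120 * C * τ ≤ 1 / 6)
    (h : ∀ K : ℕ, ∑ k ∈ Finset.range K, logPsi (m k) ≤ τ ^ 2 * K)
    {p : ℕ → ℕ → ℝ} {N : ℕ}
    (hp : ∀ k ν, k < N → ν < N → |p k ν| ≤ C * (m k / ((k : ℝ) + 1)))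
    (hE : ∀ E ⊆ Finset.range N, ∑ ν ∈ Finset.range N, (∑ k ∈ E, p k ν) ^ 2 ≤
      C * N * ∑ k ∈ E, (m k / ((k : ℝ) + 1)) ^ 2) :
    ∑ ν ∈ Finset.range N, expPhi |∑ k ∈ Finset.range N, p k ν| ≤ N * (40 * (3120 * C * τ)) := by
  set κ := 3120 * C * τ with hκ
  have hκ0 : 0 < κ := by positivity
  have hτ1 : τ ≤ 1 := by nlinarith
  set a : ℕ → ℝ := fun k => m k / ((k : ℝ) + 1) with hadef
  have ha : ∀ k, 0 ≤ a k := fun k => div_nonneg (hm k) (by positivity)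
  have he := Real.exp_one_lt_d9
  -- The exponent at level j. Since 3120 = 6·520, the power sum is at most (j+1)/(6C), and e < 3
  -- then keeps the large terms below (j+1)/2.
  set s : ℕ → ℝ := fun j => κ / ((j : ℝ) + 1) with hsdef
  have hs0 : ∀ j, 0 < s j := fun j => by positivity
  have hs1 : ∀ j, s j ≤ 1 := fun j => by
    simp only [hsdef]
    rw [div_le_one (by positivity)]
    have := Nat.cast_nonneg (α := ℝ) j
    linarith
  have hsj : ∀ j : ℕ, 520 * τ / s j = ((j : ℝ) + 1) / (6 * C) := fun j => by
    simp only [hsdef, hκ]; field_simp; norm_num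
  have hS : ∀ j : ℕ, ∑ k ∈ Finset.range N, a k ^ (1 + s j) ≤ ((j : ℝ) + 1) / (6 * C) :=
    fun j => (hsj j) ▸ sum_rpow_div_le hm hτ hτ1 h (hs0 j) (hs1 j) N
  set A1 : ℕ → ℕ → ℝ := fun j ν =>
    ∑ k ∈ Finset.range N with ¬ a k ≤ Real.exp (-(1 / s j)), p k ν with hA1
  set A2 : ℕ → ℕ → ℝ := fun j ν =>
    ∑ k ∈ Finset.range N with a k ≤ Real.exp (-(1 / s j)), p k ν with hA2
  have hsplit : ∀ j ν, ∑ k ∈ Finset.range N, p k ν = A2 j ν + A1 j ν := fun j ν =>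
    (Finset.sum_filter_add_sum_filter_not _ _ _).symm
  have hA1b : ∀ j ν, ν < N → |A1 j ν| ≤ ((j : ℝ) + 1) / 2 := by
    intro j ν hν
    calc |A1 j ν| ≤ ∑ k ∈ Finset.range N with ¬ a k ≤ Real.exp (-(1 / s j)), |p k ν| :=
          Finset.abs_sum_le_sum_abs _ _
      _ ≤ ∑ k ∈ Finset.range N with ¬ a k ≤ Real.exp (-(1 / s j)), C * a k :=
          Finset.sum_le_sum fun k hk =>
            hp k ν (Finset.mem_range.1 (Finset.mem_filter.1 hk).1) hν
      _ ≤ C * (Real.exp 1 * (((j : ℝ) + 1) / (6 * C))) := by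
          rw [← Finset.mul_sum]
          gcongr
          exact sum_large_le ha (hs0 j) (hS j)
      _ = Real.exp 1 * (((j : ℝ) + 1) / 6) := by field_simp
      _ ≤ 3 * (((j : ℝ) + 1) / 6) := by gcongr; linarith
      _ = _ := by ring
  have hA2b : ∀ j, ∑ ν ∈ Finset.range N, A2 j ν ^ 2 ≤
      N * (Real.exp (-(1 / s j)) * (((j : ℝ) + 1) / 2)) := by
    intro j
    refine (hE _ (Finset.filter_subset _ _)).trans ?_
    calc C * N * ∑ k ∈ Finset.range N with a k ≤ Real.exp (-(1 / s j)), a k ^ 2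
        ≤ C * N * (Real.exp 1 * Real.exp (-(1 / s j)) * (((j : ℝ) + 1) / (6 * C))) := by
          gcongr
          exact sum_small_sq_le ha (hs0 j) (hs1 j) (hS j)
      _ = N * (Real.exp (-(1 / s j)) * (Real.exp 1 * (((j : ℝ) + 1) / 6))) := by field_simp
      _ ≤ N * (Real.exp (-(1 / s j)) * (3 * (((j : ℝ) + 1) / 6))) := by gcongr; linarith
      _ = _ := by ring
  have hAsq : ∑ ν ∈ Finset.range N, (∑ k ∈ Finset.range N, p k ν) ^ 2 ≤ N * κ := by
    refine (hE _ subset_rfl).trans ?_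
    have h1 := sum_rpow_div_le hm hτ hτ1 h one_pos le_rfl N
    have h2 : ∀ x : ℝ, x ^ ((1 : ℝ) + 1) = x ^ 2 := fun x => by
      rw [← Real.rpow_natCast]; norm_num
    simp only [h2, div_one] at h1
    calc C * N * ∑ k ∈ Finset.range N, (m k / ((k : ℝ) + 1)) ^ 2 ≤ C * N * (520 * τ) := by gcongr
      _ = N * (520 * C * τ) := by ring
      _ ≤ _ := by
        gcongr
        rw [hκ]; gcongr; norm_num
  obtain ⟨J, hJ⟩ : ∃ J : ℕ, ∀ ν ∈ Finset.range N, |∑ k ∈ Finset.range N, p k ν| ≤ J := by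
    refine ⟨⌈∑ ν ∈ Finset.range N, |∑ k ∈ Finset.range N, p k ν|⌉₊, fun ν hν => ?_⟩
    exact (Finset.single_le_sum (f := fun ν => |∑ k ∈ Finset.range N, p k ν|)
      (fun _ _ => abs_nonneg _) hν).trans (Nat.le_ceil _)
  have hpt : ∀ ν ∈ Finset.range N, expPhi |∑ k ∈ Finset.range N, p k ν| ≤
      (∑ k ∈ Finset.range N, p k ν) ^ 2 + ∑ j ∈ Finset.range J,
        Real.exp ((j : ℝ) + 2) * (4 / ((j : ℝ) + 1) ^ 2 * A2 j ν ^ 2) := by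
    intro ν hν
    rw [← sq_abs (∑ k ∈ Finset.range N, p k ν)]
    refine expPhi_le_sq_add_sum (abs_nonneg _) (fun j => by positivity) (fun j hj => ?_) (hJ ν hν)
    have h1 := hA1b j ν (Finset.mem_range.1 hν)
    rw [hsplit j ν] at hj
    have h2 := abs_add_le (A2 j ν) (A1 j ν)
    have h3 : ((j : ℝ) + 1) / 2 ≤ |A2 j ν| := by linarith
    have h4 : (((j : ℝ) + 1) / 2) ^ 2 ≤ A2 j ν ^ 2 := by
      rw [← sq_abs (A2 j ν)]; gcongr
    rw [div_mul_eq_mul_div, le_div_iff₀ (by positivity)]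
    linarith
  -- Ratio of the geometric series over levels: e^{j+2} e^{-(j+1)/κ} = e·r^{j+1}. One factor r is
  -- kept aside, since r ≤ eκ makes the total O(κ).
  set r := Real.exp (1 - 1 / κ) with hr
  have hr0 : 0 < r := Real.exp_pos _
  have hrκ : r ≤ Real.exp 1 * κ := exp_one_sub_inv_le hκ0
  have hr2 : r ≤ 1 / 2 := by nlinarith
  have hlevel : ∀ j : ℕ, Real.exp ((j : ℝ) + 2) * (4 / ((j : ℝ) + 1) ^ 2 *
      ∑ ν ∈ Finset.range N, A2 j ν ^ 2) ≤ N * (2 * Real.exp 1 * r * (1 / 2) ^ j) := by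
    intro j
    have h1 : Real.exp ((j : ℝ) + 2) * Real.exp (-(1 / s j)) = Real.exp 1 * r ^ (j + 1) := by
      rw [hr, ← Real.exp_nat_mul, ← Real.exp_add, ← Real.exp_add]
      congr 1
      simp only [hsdef]
      push_cast
      field_simp
      ring
    calc _ ≤ Real.exp ((j : ℝ) + 2) * (4 / ((j : ℝ) + 1) ^ 2 *
          (N * (Real.exp (-(1 / s j)) * (((j : ℝ) + 1) / 2)))) := by gcongr; exact hA2b j
      _ = N * ((Real.exp ((j : ℝ) + 2) * Real.exp (-(1 / s j))) * (2 / ((j : ℝ) + 1))) := by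
        field_simp; ring
      _ = N * (Real.exp 1 * r * r ^ j * (2 / ((j : ℝ) + 1))) := by rw [h1]; ring
      _ ≤ N * (Real.exp 1 * r * (1 / 2) ^ j * 2) := by
        gcongr
        rw [div_le_iff₀ (by positivity)]
        have := Nat.cast_nonneg (α := ℝ) j
        linarith
      _ = _ := by ring
  calc _ ≤ ∑ ν ∈ Finset.range N, ((∑ k ∈ Finset.range N, p k ν) ^ 2 + ∑ j ∈ Finset.range J,
        Real.exp ((j : ℝ) + 2) * (4 / ((j : ℝ) + 1) ^ 2 * A2 j ν ^ 2)) := Finset.sum_le_sum hpt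
    _ = ∑ ν ∈ Finset.range N, (∑ k ∈ Finset.range N, p k ν) ^ 2 + ∑ j ∈ Finset.range J,
        Real.exp ((j : ℝ) + 2) * (4 / ((j : ℝ) + 1) ^ 2 * ∑ ν ∈ Finset.range N, A2 j ν ^ 2) := by
      rw [Finset.sum_add_distrib, Finset.sum_comm]
      simp only [Finset.mul_sum]
    _ ≤ N * κ + ∑ j ∈ Finset.range J, N * (2 * Real.exp 1 * r * (1 / 2) ^ j) := by
      exact add_le_add hAsq (Finset.sum_le_sum fun j _ => hlevel j)
    _ = N * (κ + 2 * Real.exp 1 * r * ∑ j ∈ Finset.range J, (1 / 2 : ℝ) ^ j) := by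
      simp only [Finset.mul_sum, mul_add]
    _ ≤ N * (κ + 2 * Real.exp 1 * (Real.exp 1 * κ) * 2) := by
      gcongr
      exact sum_geometric_two_le J
    _ ≤ N * (40 * κ) := by
      gcongr
      have : Real.exp 1 * Real.exp 1 ≤ 8 := by nlinarith [Real.exp_pos 1]
      nlinarith

/-! ### The Dirichlet kernel. -/

/-- The Dirichlet kernel `1/2 + ∑_{k=1}^ν cos kt`. -/
noncomputable def dirichletKernel (ν : ℕ) (t : ℝ) : ℝ :=
  1 / 2 + ∑ k ∈ Finset.Icc 1 ν, Real.cos (k * t)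

theorem continuous_dirichletKernel (ν : ℕ) : Continuous (dirichletKernel ν) := by
  unfold dirichletKernel; fun_prop

theorem dirichletKernel_succ (ν : ℕ) (t : ℝ) :
    dirichletKernel (ν + 1) t = dirichletKernel ν t + Real.cos (((ν : ℝ) + 1) * t) := by
  simp only [dirichletKernel]
  rw [Finset.sum_Icc_succ_top (by omega)]
  push_cast
  ring

theorem dirichletKernel_neg (ν : ℕ) (t : ℝ) : dirichletKernel ν (-t) = dirichletKernel ν t := by
  simp [dirichletKernel]

theorem two_sin_mul_dirichletKernel (ν : ℕ) (t : ℝ) :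
    2 * Real.sin (t / 2) * dirichletKernel ν t = Real.sin (((ν : ℝ) + 1 / 2) * t) := by
  induction ν with
  | zero => simp [dirichletKernel]; ring_nf
  | succ n ih =>
    rw [dirichletKernel_succ, mul_add, ih]
    have h1 : Real.sin ((((n + 1 : ℕ) : ℝ) + 1 / 2) * t) =
        Real.sin (((n : ℝ) + 1) * t + t / 2) := by push_cast; ring_nf
    have h2 : Real.sin (((n : ℝ) + 1 / 2) * t) = Real.sin (((n : ℝ) + 1) * t - t / 2) := by
      ring_nf
    rw [h1, h2, Real.sin_add, Real.sin_sub]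
    ring

theorem abs_dirichletKernel_le (ν : ℕ) (t : ℝ) : |dirichletKernel ν t| ≤ ν + 1 / 2 := by
  induction ν with
  | zero => simp [dirichletKernel]
  | succ n ih =>
    rw [dirichletKernel_succ]
    have h1 := abs_add_le (dirichletKernel n t) (Real.cos (((n : ℝ) + 1) * t))
    have h2 := Real.abs_cos_le_one (((n : ℝ) + 1) * t)
    push_cast
    linarith

theorem integral_cos_int_mul {j : ℤ} (hj : j ≠ 0) : ∫ t in (0 : ℝ)..π, Real.cos (j * t) = 0 := by
  have hj' : (j : ℝ) ≠ 0 := by exact_mod_cast hj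
  rw [intervalIntegral.integral_comp_mul_left (fun x => Real.cos x) hj', integral_cos]
  simp [Real.sin_int_mul_pi]

theorem integral_dirichletKernel (ν : ℕ) : ∫ t in (0 : ℝ)..π, dirichletKernel ν t = π / 2 := by
  induction ν with
  | zero => simp [dirichletKernel]; ring
  | succ n ih =>
    simp only [dirichletKernel_succ]
    rw [intervalIntegral.integral_add ((continuous_dirichletKernel n).intervalIntegrable _ _)
      ((by fun_prop : Continuous fun t : ℝ => Real.cos (((n : ℝ) + 1) * t)).intervalIntegrable _ _),
      ih]
    have := integral_cos_int_mul (j := (n : ℤ) + 1) (by omega)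
    push_cast at this
    rw [this, add_zero]

/-! ### Half-integer frequencies: orthogonality and the large sieve. -/

theorem integral_sin_mul_sin (ν μ : ℕ) :
    ∫ t in (0 : ℝ)..π, Real.sin (((ν : ℝ) + 1 / 2) * t) * Real.sin (((μ : ℝ) + 1 / 2) * t) =
      if ν = μ then π / 2 else 0 := by
  have h : ∀ t : ℝ, Real.sin (((ν : ℝ) + 1 / 2) * t) * Real.sin (((μ : ℝ) + 1 / 2) * t) =
      1 / 2 * Real.cos (((ν : ℤ) - (μ : ℤ) : ℤ) * t) -
        1 / 2 * Real.cos (((ν : ℤ) + μ + 1 : ℤ) * t) := by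
    intro t
    have h1 : (((ν : ℤ) - (μ : ℤ) : ℤ) : ℝ) * t =
        ((ν : ℝ) + 1 / 2) * t - ((μ : ℝ) + 1 / 2) * t := by push_cast; ring
    have h2 : (((ν : ℤ) + μ + 1 : ℤ) : ℝ) * t =
        ((ν : ℝ) + 1 / 2) * t + ((μ : ℝ) + 1 / 2) * t := by push_cast; ring
    rw [h1, h2, Real.cos_add, Real.cos_sub]
    ring
  simp only [h]
  rw [intervalIntegral.integral_sub (Continuous.intervalIntegrable (by fun_prop) _ _)
    (Continuous.intervalIntegrable (by fun_prop) _ _), intervalIntegral.integral_const_mul,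
    intervalIntegral.integral_const_mul, integral_cos_int_mul (j := (ν : ℤ) + μ + 1) (by omega)]
  split_ifs with hνμ
  · subst hνμ; simp; ring
  · rw [integral_cos_int_mul (by omega)]; simp

theorem integral_cos_mul_cos (ν μ : ℕ) :
    ∫ t in (0 : ℝ)..π, Real.cos (((ν : ℝ) + 1 / 2) * t) * Real.cos (((μ : ℝ) + 1 / 2) * t) =
      if ν = μ then π / 2 else 0 := by
  have h : ∀ t : ℝ, Real.cos (((ν : ℝ) + 1 / 2) * t) * Real.cos (((μ : ℝ) + 1 / 2) * t) =
      1 / 2 * Real.cos (((ν : ℤ) - (μ : ℤ) : ℤ) * t) +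
        1 / 2 * Real.cos (((ν : ℤ) + μ + 1 : ℤ) * t) := by
    intro t
    have h1 : (((ν : ℤ) - (μ : ℤ) : ℤ) : ℝ) * t =
        ((ν : ℝ) + 1 / 2) * t - ((μ : ℝ) + 1 / 2) * t := by push_cast; ring
    have h2 : (((ν : ℤ) + μ + 1 : ℤ) : ℝ) * t =
        ((ν : ℝ) + 1 / 2) * t + ((μ : ℝ) + 1 / 2) * t := by push_cast; ring
    rw [h1, h2, Real.cos_add, Real.cos_sub]
    ring
  simp only [h]
  rw [intervalIntegral.integral_add (Continuous.intervalIntegrable (by fun_prop) _ _)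
    (Continuous.intervalIntegrable (by fun_prop) _ _), intervalIntegral.integral_const_mul,
    intervalIntegral.integral_const_mul, integral_cos_int_mul (j := (ν : ℤ) + μ + 1) (by omega)]
  split_ifs with hνμ
  · subst hνμ; simp; ring
  · rw [integral_cos_int_mul (by omega)]; simp

theorem integral_sq_sum_of_orthogonal {e : ℕ → ℝ → ℝ} (he : ∀ ν, Continuous (e ν))
    (ho : ∀ ν μ, ∫ t in (0 : ℝ)..π, e ν t * e μ t = if ν = μ then π / 2 else 0)
    (N : ℕ) (c : ℕ → ℝ) :
    ∫ t in (0 : ℝ)..π, (∑ ν ∈ Finset.range N, c ν * e ν t) ^ 2 =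
      π / 2 * ∑ ν ∈ Finset.range N, c ν ^ 2 := by
  have h : ∀ t : ℝ, (∑ ν ∈ Finset.range N, c ν * e ν t) ^ 2 =
      ∑ ν ∈ Finset.range N, ∑ μ ∈ Finset.range N, (c ν * c μ) * (e ν t * e μ t) := by
    intro t
    rw [sq, Finset.sum_mul_sum]
    refine Finset.sum_congr rfl fun ν _ => Finset.sum_congr rfl fun μ _ => by ring
  simp only [h]
  rw [intervalIntegral.integral_finsetSum
    fun ν _ => Continuous.intervalIntegrable (by fun_prop) _ _, Finset.mul_sum]
  refine Finset.sum_congr rfl fun ν hν => ?_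
  rw [intervalIntegral.integral_finsetSum
    fun μ _ => Continuous.intervalIntegrable (by fun_prop) _ _]
  simp only [intervalIntegral.integral_const_mul, ho]
  rw [Finset.sum_eq_single_of_mem ν hν fun μ _ hμ => by simp [Ne.symm hμ]]
  simp; ring

/-- A Sobolev bound for the square of a `C¹` function. -/
theorem sq_le_integral_add_integral {T T' : ℝ → ℝ} (hT : ∀ t, HasDerivAt T (T' t) t)
    (hT' : Continuous T') {a b n t : ℝ} (hab : a < b) (hn : 0 < n) (ht : t ∈ Set.Icc a b) :
    T t ^ 2 ≤ 1 / (b - a) * (∫ u in a..b, T u ^ 2) +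
      ∫ u in a..b, (n * T u ^ 2 + 1 / n * T' u ^ 2) := by
  have hTc : Continuous T := continuous_iff_continuousAt.2 fun t => (hT t).continuousAt
  set q : ℝ → ℝ := fun u => n * T u ^ 2 + 1 / n * T' u ^ 2 with hq
  have hqc : Continuous q := by fun_prop
  have hq0 : ∀ u, 0 ≤ q u := fun u => by positivity
  have hq1 : ∀ u, |2 * T u * T' u| ≤ q u := by
    intro u
    have h1 : q u = n * (T u ^ 2 + (T' u / n) ^ 2) := by simp only [hq]; field_simp
    have h2 : |2 * T u * T' u| = n * |2 * T u * (T' u / n)| := by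
      rw [← abs_of_pos hn, ← abs_mul, abs_of_pos hn]; congr 1; field_simp
    rw [h1, h2]
    gcongr
    rw [abs_le]
    constructor <;> nlinarith [sq_nonneg (T u + T' u / n), sq_nonneg (T u - T' u / n)]
  have hd : ∀ u, HasDerivAt (fun u => T u ^ 2) (2 * T u * T' u) u := fun u => by
    simpa using (hT u).fun_pow 2
  have hFTC : ∀ u v, ∫ x in u..v, 2 * T x * T' x = T v ^ 2 - T u ^ 2 := fun u v =>
    intervalIntegral.integral_eq_sub_of_hasDerivAt (fun x _ => hd x)
      (Continuous.intervalIntegrable (by fun_prop) _ _)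
  have hsub : ∀ u v, a ≤ u → u ≤ v → v ≤ b → |T v ^ 2 - T u ^ 2| ≤ ∫ x in a..b, q x := by
    intro u v hau huv hvb
    rw [← hFTC]
    calc |∫ x in u..v, 2 * T x * T' x| ≤ ∫ x in u..v, |2 * T x * T' x| :=
          intervalIntegral.abs_integral_le_integral_abs huv
      _ ≤ ∫ x in u..v, q x :=
          intervalIntegral.integral_mono_on huv (Continuous.intervalIntegrable (by fun_prop) _ _)
            (hqc.intervalIntegrable _ _) fun x _ => hq1 x
      _ ≤ ∫ x in a..b, q x :=
          intervalIntegral.integral_mono_interval hau huv hvb (ae_of_all _ hq0)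
            (hqc.intervalIntegrable _ _)
  have hu : ∀ u ∈ Set.Icc a b, T t ^ 2 - ∫ x in a..b, q x ≤ T u ^ 2 := by
    intro u hu
    rcases le_total u t with h | h
    · have := (le_abs_self _).trans (hsub u t hu.1 h ht.2); linarith
    · have := (neg_abs_le _).trans' (neg_le_neg (hsub t u ht.1 h hu.2)); linarith
  have hint := intervalIntegral.integral_mono_on hab.le
    (continuous_const.intervalIntegrable (μ := volume) a b)
    (Continuous.intervalIntegrable (u := fun u => T u ^ 2) (by fun_prop) _ _) hu
  rw [intervalIntegral.integral_const, smul_eq_mul] at hint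
  have hba : 0 < b - a := sub_pos.2 hab
  have : T t ^ 2 - ∫ x in a..b, q x ≤ 1 / (b - a) * ∫ u in a..b, T u ^ 2 := by
    rw [one_div, ← div_eq_inv_mul, le_div_iff₀ hba]
    linarith
  linarith

/-- A large sieve inequality: the frequencies `ν + 1/2`, `ν < N`, do not resolve mass inside an
interval of length `π / N`. -/
theorem sum_sq_integral_sin_le {N : ℕ} (hN : 0 < N) {g : ℝ → ℝ} {E : Finset ℕ}
    (hE : E ⊆ Finset.range N) {α : ℕ → ℝ}
    (hg : ∀ k ∈ E, IntervalIntegrable g volume (k * (π / N)) ((k + 1 : ℕ) * (π / N)))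
    (hα : ∀ k ∈ E, ∫ t in (k * (π / N))..((k + 1 : ℕ) * (π / N)), |g t| ≤ α k) :
    ∑ ν ∈ Finset.range N, (∑ k ∈ E, ∫ t in (k * (π / N))..((k + 1 : ℕ) * (π / N)),
      g t * Real.sin (((ν : ℝ) + 1 / 2) * t)) ^ 2 ≤ 4 * N * ∑ k ∈ E, α k ^ 2 := by
  have hN' : (0 : ℝ) < N := by exact_mod_cast hN
  have hπN : 0 < π / N := by positivity
  set x : ℕ → ℝ := fun k => k * (π / N) with hx
  have hxlt : ∀ k, x k < x (k + 1) := fun k => by simp only [hx]; push_cast; nlinarith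
  set c : ℕ → ℝ := fun ν => ∑ k ∈ E, ∫ t in (x k)..(x (k + 1)),
    g t * Real.sin (((ν : ℝ) + 1 / 2) * t) with hc
  set T : ℝ → ℝ := fun t => ∑ ν ∈ Finset.range N, c ν * Real.sin (((ν : ℝ) + 1 / 2) * t) with hTdef
  -- Duality: T has as coefficients the very sums to be estimated, so ∑ c_ν² = ∑_k ∫ gT. It remains
  -- to control the supremum of |T| on each interval.
  set T' : ℝ → ℝ := fun t => ∑ ν ∈ Finset.range N,
    (c ν * ((ν : ℝ) + 1 / 2)) * Real.cos (((ν : ℝ) + 1 / 2) * t) with hT'def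
  have hT'c : Continuous T' := by fun_prop
  have hTc : Continuous T := by fun_prop
  have hTd : ∀ t, HasDerivAt T (T' t) t := by
    intro t
    refine HasDerivAt.fun_sum fun ν _ => ?_
    have h1 : HasDerivAt (fun t : ℝ => ((ν : ℝ) + 1 / 2) * t) ((ν : ℝ) + 1 / 2) t := by
      simpa using (hasDerivAt_id t).const_mul ((ν : ℝ) + 1 / 2)
    exact ((h1.sin).const_mul (c ν)).congr_deriv (by ring)
  set S := ∑ ν ∈ Finset.range N, c ν ^ 2 with hS
  have hS0 : 0 ≤ S := Finset.sum_nonneg fun _ _ => sq_nonneg _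
  have hIT : ∫ t in (0 : ℝ)..π, T t ^ 2 = π / 2 * S :=
    integral_sq_sum_of_orthogonal (e := fun ν t => Real.sin (((ν : ℝ) + 1 / 2) * t))
      (fun ν => by fun_prop) integral_sin_mul_sin N c
  have hIT' : ∫ t in (0 : ℝ)..π, T' t ^ 2 ≤ π / 2 * (N ^ 2 * S) := by
    rw [hT'def, integral_sq_sum_of_orthogonal (e := fun ν t => Real.cos (((ν : ℝ) + 1 / 2) * t))
      (fun ν => by fun_prop) integral_cos_mul_cos N, hS]
    gcongr
    rw [Finset.mul_sum]
    refine Finset.sum_le_sum fun ν hν => ?_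
    have : (ν : ℝ) + 1 ≤ N := by exact_mod_cast Finset.mem_range.1 hν
    rw [mul_pow, mul_comm]
    gcongr
    linarith
  set R : ℕ → ℝ := fun k => N / π * (∫ u in (x k)..(x (k + 1)), T u ^ 2) +
      ∫ u in (x k)..(x (k + 1)), (N * T u ^ 2 + 1 / N * T' u ^ 2) with hR
  have hR0 : ∀ k, 0 ≤ R k := fun k => by
    have h1 := intervalIntegral.integral_nonneg_of_forall (μ := volume) (hxlt k).le
      (fun u => sq_nonneg (T u))
    have h2 := intervalIntegral.integral_nonneg_of_forall (μ := volume) (hxlt k).le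
      (fun u => (by positivity : 0 ≤ N * T u ^ 2 + 1 / N * T' u ^ 2))
    positivity
  have hTR : ∀ k, ∀ t ∈ Set.Icc (x k) (x (k + 1)), |T t| ≤ Real.sqrt (R k) := by
    intro k t ht
    refine Real.abs_le_sqrt ?_
    have h1 := sq_le_integral_add_integral hTd hT'c (hxlt k) hN' ht
    have h2 : 1 / (x (k + 1) - x k) = N / π := by
      simp only [hx]; push_cast; rw [← sub_mul]; simp
    rwa [h2] at h1
  -- Adjacent intervals recombine into [0, π], where orthogonality evaluates ∫T² and bounds ∫T'².
  -- The constant is 1/2 + π/2 + π/2 < 4.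
  have hRsum : ∑ k ∈ Finset.range N, R k ≤ 4 * N * S := by
    simp only [hR, Finset.sum_add_distrib, ← Finset.mul_sum]
    rw [intervalIntegral.sum_integral_adjacent_intervals
      fun k _ => Continuous.intervalIntegrable (by fun_prop) _ _,
      intervalIntegral.sum_integral_adjacent_intervals
      fun k _ => Continuous.intervalIntegrable (by fun_prop) _ _]
    have hx0 : x 0 = 0 := by simp [hx]
    have hxN : x N = π := by simp only [hx]; field_simp
    rw [hx0, hxN, intervalIntegral.integral_add (Continuous.intervalIntegrable (by fun_prop) _ _)
      (Continuous.intervalIntegrable (by fun_prop) _ _), intervalIntegral.integral_const_mul,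
      intervalIntegral.integral_const_mul, hIT]
    have h1 : 1 / N * ∫ t in (0 : ℝ)..π, T' t ^ 2 ≤ 1 / N * (π / 2 * (N ^ 2 * S)) := by gcongr
    have h2 : 1 / N * (π / 2 * (N ^ 2 * S)) = π / 2 * (N * S) := by field_simp
    have h3 : N / π * (π / 2 * S) = 1 / 2 * (N * S) := by field_simp
    have h4 : N * (π / 2 * S) = π / 2 * (N * S) := by ring
    have h5 : 0 ≤ N * S := by positivity
    rw [h3, h4]
    nlinarith [Real.pi_lt_d2]
  have hdual : S ≤ ∑ k ∈ E, α k * Real.sqrt (R k) := by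
    have h1 : S = ∑ k ∈ E, ∫ t in (x k)..(x (k + 1)), g t * T t := by
      have h2 : ∀ k ∈ E, ∫ t in (x k)..(x (k + 1)), g t * T t = ∑ ν ∈ Finset.range N,
          c ν * ∫ t in (x k)..(x (k + 1)), g t * Real.sin (((ν : ℝ) + 1 / 2) * t) := by
        intro k hk
        simp only [← intervalIntegral.integral_const_mul]
        rw [← intervalIntegral.integral_finsetSum]
        · congr 1; ext t
          simp only [hTdef, Finset.mul_sum]
          exact Finset.sum_congr rfl fun ν _ => by ring
        · intro ν _
          exact ((hg k hk).mul_continuousOn (by fun_prop)).const_mul _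
      rw [Finset.sum_congr rfl h2, Finset.sum_comm, hS]
      refine Finset.sum_congr rfl fun ν _ => ?_
      rw [← Finset.mul_sum, sq]
    rw [h1]
    refine Finset.sum_le_sum fun k hk => ?_
    calc ∫ t in (x k)..(x (k + 1)), g t * T t
        ≤ ∫ t in (x k)..(x (k + 1)), |g t| * Real.sqrt (R k) := by
          refine intervalIntegral.integral_mono_on (hxlt k).le
            ((hg k hk).mul_continuousOn hTc.continuousOn) ((hg k hk).abs.mul_const _)
            fun t ht => ?_
          calc g t * T t ≤ |g t * T t| := le_abs_self _
            _ = |g t| * |T t| := abs_mul _ _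
            _ ≤ _ := by gcongr; exact hTR k t ht
      _ = (∫ t in (x k)..(x (k + 1)), |g t|) * Real.sqrt (R k) :=
          intervalIntegral.integral_mul_const _ _
      _ ≤ α k * Real.sqrt (R k) := by gcongr; exact hα k hk
  have hCS : S ^ 2 ≤ (∑ k ∈ E, α k ^ 2) * (4 * N * S) := by
    calc S ^ 2 ≤ (∑ k ∈ E, α k * Real.sqrt (R k)) ^ 2 := by gcongr
      _ ≤ (∑ k ∈ E, α k ^ 2) * ∑ k ∈ E, Real.sqrt (R k) ^ 2 :=
          Finset.sum_mul_sq_le_sq_mul_sq _ _ _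
      _ ≤ _ := by
          have h0 : 0 ≤ ∑ k ∈ E, α k ^ 2 := Finset.sum_nonneg fun _ _ => sq_nonneg _
          gcongr
          calc ∑ k ∈ E, Real.sqrt (R k) ^ 2 = ∑ k ∈ E, R k :=
                Finset.sum_congr rfl fun k _ => Real.sq_sqrt (hR0 k)
            _ ≤ ∑ k ∈ Finset.range N, R k :=
                Finset.sum_le_sum_of_subset_of_nonneg hE fun k _ _ => hR0 k
            _ ≤ _ := hRsum
  have h0 : 0 ≤ ∑ k ∈ E, α k ^ 2 := Finset.sum_nonneg fun _ _ => sq_nonneg _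
  rcases hS0.eq_or_lt with h | h
  · rw [← h]; positivity
  · refine le_of_mul_le_mul_right ?_ h
    linarith

/-! ### Local averages and the part of the integral near 0. -/

/-- Jensen's inequality for `logPsi` on an interval. -/
theorem logPsi_average_le {φ : ℝ → ℝ} {a b : ℝ} (hab : a < b)
    (hφ : IntervalIntegrable φ volume a b)
    (hψ : IntervalIntegrable (fun t => logPsi |φ t|) volume a b) :
    logPsi (1 / (b - a) * ∫ t in a..b, |φ t|) ≤ 1 / (b - a) * ∫ t in a..b, logPsi |φ t| := by
  have hba : 0 < b - a := sub_pos.2 hab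
  set M := 1 / (b - a) * ∫ t in a..b, |φ t| with hM
  have hI0 : 0 ≤ ∫ t in a..b, |φ t| :=
    intervalIntegral.integral_nonneg_of_forall hab.le fun _ => abs_nonneg _
  have hM0 : 0 ≤ M := by positivity
  set l := Real.log (1 + M) with hl
  have hl0 : 0 ≤ l := Real.log_nonneg (by linarith)
  have h1 : ∫ t in a..b, (l * |φ t| - expPhi l) ≤ ∫ t in a..b, logPsi |φ t| := by
    refine intervalIntegral.integral_mono_on hab.le ((hφ.abs.const_mul l).sub (by simp)) hψ
      fun t _ => ?_
    have := young_mul_le hl0 (abs_nonneg (φ t))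
    linarith
  rw [intervalIntegral.integral_sub (hφ.abs.const_mul l) (by simp),
    intervalIntegral.integral_const_mul, intervalIntegral.integral_const, smul_eq_mul] at h1
  rw [logPsi_eq_young hM0, ← hl]
  have h2 : l * M - expPhi l =
      1 / (b - a) * (l * (∫ t in a..b, |φ t|) - (b - a) * expPhi l) := by
    rw [hM]; field_simp
  rw [h2]
  gcongr

theorem sin_half_pos_of_mem {N k : ℕ} (hk : k < N) (hk0 : 0 < k) {t : ℝ}
    (ht : t ∈ Set.Icc (k * (π / N)) ((k + 1 : ℕ) * (π / N))) : 0 < Real.sin (t / 2) := by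
  have hN : (0 : ℝ) < N := by exact_mod_cast (Nat.zero_lt_of_lt hk)
  have hk' : (0 : ℝ) < k := by exact_mod_cast hk0
  have hkN : ((k + 1 : ℕ) : ℝ) ≤ N := by exact_mod_cast hk
  have ht0 : 0 < t := lt_of_lt_of_le (by positivity) ht.1
  have htπ : t ≤ π := ht.2.trans (by
    calc ((k + 1 : ℕ) : ℝ) * (π / N) ≤ N * (π / N) := by gcongr
      _ = π := by field_simp)
  exact Real.sin_pos_of_pos_of_lt_pi (by positivity) (by linarith [Real.pi_pos])

/-- On the `k`-th interval, `1 / (2 sin (t/2)) ≤ N / (k + 1)`. -/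
theorem inv_two_sin_half_le {N k : ℕ} (hk : k < N) (hk0 : 0 < k) {t : ℝ}
    (ht : t ∈ Set.Icc (k * (π / N)) ((k + 1 : ℕ) * (π / N))) :
    (2 * Real.sin (t / 2))⁻¹ ≤ N / ((k : ℝ) + 1) := by
  have hN : (0 : ℝ) < N := by exact_mod_cast (Nat.zero_lt_of_lt hk)
  have hk1 : (1 : ℝ) ≤ k := by exact_mod_cast hk0
  have hkN : ((k + 1 : ℕ) : ℝ) ≤ N := by exact_mod_cast hk
  have ht0 : 0 < t := lt_of_lt_of_le (by positivity) ht.1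
  have htπ : t ≤ π := ht.2.trans (by
    calc ((k + 1 : ℕ) : ℝ) * (π / N) ≤ N * (π / N) := by gcongr
      _ = π := by field_simp)
  have hs : k / N ≤ Real.sin (t / 2) := by
    have h1 := Real.mul_le_sin (x := t / 2) (by positivity) (by linarith)
    calc k / N = 2 / π * (k * (π / N) / 2) := by field_simp
      _ ≤ 2 / π * (t / 2) := by gcongr; exact ht.1
      _ ≤ _ := h1
  have hs0 : 0 < Real.sin (t / 2) := lt_of_lt_of_le (by positivity) hs
  rw [inv_le_comm₀ (by positivity) (by positivity), inv_div]
  calc ((k : ℝ) + 1) / N ≤ (2 * k) / N := by gcongr; linarith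
    _ = 2 * (k / N) := by ring
    _ ≤ _ := by gcongr

theorem abs_dirichletKernel_le_div {N k ν : ℕ} (hk : k < N) (hν : ν < N) {t : ℝ}
    (ht : t ∈ Set.Icc (k * (π / N)) ((k + 1 : ℕ) * (π / N))) :
    |dirichletKernel ν t| ≤ N / ((k : ℝ) + 1) := by
  rcases Nat.eq_zero_or_pos k with rfl | hk0
  · have hν' : (ν : ℝ) + 1 ≤ N := by exact_mod_cast hν
    have := abs_dirichletKernel_le ν t
    simp
    linarith
  · have hs := sin_half_pos_of_mem hk hk0 ht
    have h0 : 0 < 2 * Real.sin (t / 2) := by positivity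
    refine le_trans ?_ (inv_two_sin_half_le hk hk0 ht)
    rw [← one_div, le_div_iff₀ h0]
    calc |dirichletKernel ν t| * (2 * Real.sin (t / 2))
        = |2 * Real.sin (t / 2) * dirichletKernel ν t| := by
          rw [abs_mul, abs_of_pos h0, mul_comm]
      _ ≤ 1 := by
          rw [two_sin_mul_dirichletKernel]
          exact Real.abs_sin_le_one _

/-- The strong exponential mean of the part of `φ` whose `Ψ`-averages are uniformly small. -/
theorem sum_expPhi_integral_le {φ : ℝ → ℝ} (hφ : ∀ a b, IntervalIntegrable φ volume a b)
    (hψ : ∀ a b, IntervalIntegrable (fun t => logPsi |φ t|) volume a b)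
    {τ : ℝ} (hτ : 0 < τ) (hsmall : 3120 * 80 * τ ≤ 1 / 6)
    (h : ∀ u, 0 ≤ u → ∫ t in (0 : ℝ)..u, logPsi |φ t| ≤ τ ^ 2 * u)
    {N : ℕ} (hN : 0 < N) :
    ∑ ν ∈ Finset.range N, expPhi |∫ t in (0 : ℝ)..π, φ t * dirichletKernel ν t| ≤
      N * (40 * (3120 * 80 * τ)) := by
  have hN' : (0 : ℝ) < N := by exact_mod_cast hN
  have hπN : 0 < π / N := by positivity
  set x : ℕ → ℝ := fun k => k * (π / N) with hx
  have hxlt : ∀ k, x k < x (k + 1) := fun k => by simp only [hx]; push_cast; nlinarith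
  have hxd : ∀ k, 1 / (x (k + 1) - x k) = N / π := fun k => by
    simp only [hx]; push_cast; rw [← sub_mul]; simp
  have hx0 : x 0 = 0 := by simp [hx]
  have hxN : x N = π := by simp only [hx]; field_simp
  set m : ℕ → ℝ := fun k => N / π * ∫ t in (x k)..(x (k + 1)), |φ t| with hm
  have hI0 : ∀ k, 0 ≤ ∫ t in (x k)..(x (k + 1)), |φ t| := fun k =>
    intervalIntegral.integral_nonneg_of_forall (hxlt k).le fun _ => abs_nonneg _
  have hm0 : ∀ k, 0 ≤ m k := fun k => by have := hI0 k; positivity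
  have hsum : ∀ K : ℕ, ∑ k ∈ Finset.range K, logPsi (m k) ≤ τ ^ 2 * K := by
    intro K
    calc ∑ k ∈ Finset.range K, logPsi (m k)
        ≤ ∑ k ∈ Finset.range K, N / π * ∫ t in (x k)..(x (k + 1)), logPsi |φ t| := by
          refine Finset.sum_le_sum fun k _ => ?_
          have := logPsi_average_le (hxlt k) (hφ _ _) (hψ _ _)
          rwa [hxd] at this
      _ = N / π * ∫ t in (0 : ℝ)..(x K), logPsi |φ t| := by
          rw [← Finset.mul_sum, intervalIntegral.sum_integral_adjacent_intervals
            fun k _ => hψ _ _, hx0]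
      _ ≤ N / π * (τ ^ 2 * x K) := by
          gcongr
          exact h _ (by simp only [hx]; positivity)
      _ = τ ^ 2 * K := by simp only [hx]; field_simp
  set p : ℕ → ℕ → ℝ := fun k ν => ∫ t in (x k)..(x (k + 1)), φ t * dirichletKernel ν t with hp
  have hpsum : ∀ ν, ∫ t in (0 : ℝ)..π, φ t * dirichletKernel ν t = ∑ k ∈ Finset.range N, p k ν := by
    intro ν
    simp only [hp]
    rw [intervalIntegral.sum_integral_adjacent_intervals
      fun k _ => (hφ _ _).mul_continuousOn (continuous_dirichletKernel ν).continuousOn, hx0, hxN]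
  have ham : ∀ k : ℕ, N / ((k : ℝ) + 1) * (∫ t in (x k)..(x (k + 1)), |φ t|) =
      π * (m k / ((k : ℝ) + 1)) := fun k => by simp only [hm]; field_simp
  have ha0 : ∀ k : ℕ, 0 ≤ m k / ((k : ℝ) + 1) := fun k => div_nonneg (hm0 k) (by positivity)
  have hpb : ∀ k ν, k < N → ν < N → |p k ν| ≤ π * (m k / ((k : ℝ) + 1)) := by
    intro k ν hk hν
    rw [← ham]
    calc |p k ν| ≤ ∫ t in (x k)..(x (k + 1)), |φ t * dirichletKernel ν t| :=
          intervalIntegral.abs_integral_le_integral_abs (hxlt k).le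
      _ ≤ ∫ t in (x k)..(x (k + 1)), N / ((k : ℝ) + 1) * |φ t| := by
          refine intervalIntegral.integral_mono_on (hxlt k).le
            ((hφ _ _).mul_continuousOn (continuous_dirichletKernel ν).continuousOn).abs
            ((hφ _ _).abs.const_mul _) fun t ht => ?_
          rw [abs_mul, mul_comm]
          gcongr
          exact abs_dirichletKernel_le_div hk hν ht
      _ = _ := intervalIntegral.integral_const_mul _ _
  have hπ2 : π ^ 2 ≤ 10 := by nlinarith [Real.pi_lt_d2, Real.pi_pos]
  simp only [hpsum]
  refine sum_expPhi_le hm0 hτ (by norm_num) hsmall hsum (fun k ν hk hν => ?_) fun E hE => ?_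
  · refine (hpb k ν hk hν).trans ?_
    gcongr
    · exact ha0 k
    · linarith [Real.pi_lt_d2]
  -- The sieve needs D_ν = sin((ν+1/2)t)/(2 sin(t/2)), singular at t = 0, so the interval k = 0 is
  -- estimated directly. For k ≥ 1 the constant is 4π² ≤ 40; (u+v)² ≤ 2u² + 2v² doubles it to 80.
  · set E' := E.erase 0 with hE'
    have hE'N : E' ⊆ Finset.range N := (Finset.erase_subset _ _).trans hE
    set g : ℝ → ℝ := fun t => φ t * (2 * Real.sin (t / 2))⁻¹ with hg
    have hlt : ∀ k ∈ E', k < N := fun k hk => Finset.mem_range.1 (hE'N hk)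
    have hpos : ∀ k ∈ E', 0 < k := fun k hk => Nat.pos_of_ne_zero (Finset.ne_of_mem_erase hk)
    have hgi : ∀ k ∈ E', IntervalIntegrable g volume (x k) (x (k + 1)) := by
      intro k hk
      refine (hφ _ _).mul_continuousOn (ContinuousOn.inv₀ (by fun_prop) fun t ht => ?_)
      rw [Set.uIcc_of_le (hxlt k).le] at ht
      have := sin_half_pos_of_mem (hlt k hk) (hpos k hk) ht
      positivity
    have hgα : ∀ k ∈ E', ∫ t in (x k)..(x (k + 1)), |g t| ≤ π * (m k / ((k : ℝ) + 1)) := by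
      intro k hk
      rw [← ham, ← intervalIntegral.integral_const_mul]
      refine intervalIntegral.integral_mono_on (hxlt k).le (hgi k hk).abs
        ((hφ _ _).abs.const_mul _) fun t ht => ?_
      have h1 := sin_half_pos_of_mem (hlt k hk) (hpos k hk) ht
      simp only [hg]
      rw [abs_mul, mul_comm, abs_of_pos (a := (2 * Real.sin (t / 2))⁻¹) (by positivity)]
      gcongr
      exact inv_two_sin_half_le (hlt k hk) (hpos k hk) ht
    have hLS := sum_sq_integral_sin_le hN hE'N hgi hgα
    have hpg : ∀ ν, ∀ k ∈ E', p k ν =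
        ∫ t in (x k)..(x (k + 1)), g t * Real.sin (((ν : ℝ) + 1 / 2) * t) := by
      intro ν k hk
      refine intervalIntegral.integral_congr fun t ht => ?_
      rw [Set.uIcc_of_le (hxlt k).le] at ht
      have h1 := sin_half_pos_of_mem (hlt k hk) (hpos k hk) ht
      simp only [hg]
      rw [← two_sin_mul_dirichletKernel]
      field_simp
    have hLS' : ∑ ν ∈ Finset.range N, (∑ k ∈ E', p k ν) ^ 2 ≤
        40 * N * ∑ k ∈ E', (m k / ((k : ℝ) + 1)) ^ 2 := by
      have h1 : ∀ ν, ∑ k ∈ E', p k ν = ∑ k ∈ E',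
          ∫ t in (x k)..(x (k + 1)), g t * Real.sin (((ν : ℝ) + 1 / 2) * t) :=
        fun ν => Finset.sum_congr rfl (hpg ν)
      simp only [h1]
      refine hLS.trans ?_
      simp only [mul_pow]
      rw [← Finset.mul_sum]
      have h0 : 0 ≤ ∑ k ∈ E', (m k / ((k : ℝ) + 1)) ^ 2 :=
        Finset.sum_nonneg fun _ _ => sq_nonneg _
      calc 4 * N * (π ^ 2 * ∑ k ∈ E', (m k / ((k : ℝ) + 1)) ^ 2)
          ≤ 4 * N * (10 * ∑ k ∈ E', (m k / ((k : ℝ) + 1)) ^ 2) := by gcongr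
        _ = _ := by ring
    by_cases h0E : 0 ∈ E
    · have hz : ∑ ν ∈ Finset.range N, p 0 ν ^ 2 ≤ N * (10 * (m 0 / (((0 : ℕ) : ℝ) + 1)) ^ 2) := by
        calc ∑ ν ∈ Finset.range N, p 0 ν ^ 2
            ≤ ∑ ν ∈ Finset.range N, 10 * (m 0 / (((0 : ℕ) : ℝ) + 1)) ^ 2 := by
              refine Finset.sum_le_sum fun ν hν => ?_
              have h1 := hpb 0 ν hN (Finset.mem_range.1 hν)
              calc p 0 ν ^ 2 = |p 0 ν| ^ 2 := (sq_abs _).symm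
                _ ≤ (π * (m 0 / (((0 : ℕ) : ℝ) + 1))) ^ 2 := by gcongr
                _ ≤ _ := by rw [mul_pow]; gcongr
          _ = _ := by simp
      have hsplit : ∀ ν, (∑ k ∈ E, p k ν) ^ 2 ≤ 2 * p 0 ν ^ 2 + 2 * (∑ k ∈ E', p k ν) ^ 2 := by
        intro ν
        rw [← Finset.add_sum_erase E _ h0E]
        nlinarith [sq_nonneg (p 0 ν - ∑ k ∈ E', p k ν)]
      rw [← Finset.add_sum_erase E _ h0E]
      calc _ ≤ ∑ ν ∈ Finset.range N, (2 * p 0 ν ^ 2 + 2 * (∑ k ∈ E', p k ν) ^ 2) :=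
            Finset.sum_le_sum fun ν _ => hsplit ν
        _ = 2 * ∑ ν ∈ Finset.range N, p 0 ν ^ 2 +
            2 * ∑ ν ∈ Finset.range N, (∑ k ∈ E', p k ν) ^ 2 := by
          rw [Finset.sum_add_distrib, Finset.mul_sum, Finset.mul_sum]
        _ ≤ 2 * (N * (10 * (m 0 / (((0 : ℕ) : ℝ) + 1)) ^ 2)) +
            2 * (40 * N * ∑ k ∈ E', (m k / ((k : ℝ) + 1)) ^ 2) := by gcongr
        _ ≤ _ := by
          have : 0 ≤ N * (m 0 / (((0 : ℕ) : ℝ) + 1)) ^ 2 := by positivity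
          rw [mul_add]
          linarith
    · have : E' = E := Finset.erase_eq_of_notMem h0E
      rw [this] at hLS'
      refine hLS'.trans ?_
      have h0 : 0 ≤ ∑ k ∈ E, (m k / ((k : ℝ) + 1)) ^ 2 :=
        Finset.sum_nonneg fun _ _ => sq_nonneg _
      gcongr
      norm_num

/-! ### Integrability of f and of its second differences. -/

theorem intervalIntegrable_logPsi_of_memLPsi {f : ℝ → ℝ} (hf : MemLPsi logPsi f) (a b : ℝ) :
    IntervalIntegrable (fun t => logPsi |f t|) volume a b := by
  have hper : Function.Periodic (fun t => logPsi |f t|) (2 * π) := fun t => by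
    simp only [hf.periodic t]
  refine hper.intervalIntegrable (by positivity) (t := -π) ?_ a b
  rw [show -π + 2 * π = π by ring, intervalIntegrable_iff_integrableOn_Icc_of_le
    (by linarith [Real.pi_pos])]
  exact hf.integrableOn

theorem intervalIntegrable_of_memLPsi {f : ℝ → ℝ} (hf : MemLPsi logPsi f) (a b : ℝ) :
    IntervalIntegrable f volume a b := by
  refine IntervalIntegrable.mono_fun'
    ((intervalIntegrable_logPsi_of_memLPsi hf a b).add
      (intervalIntegrable_const (c := expPhi 1)))
    hf.aemeasurable.aestronglyMeasurable.restrict (ae_of_all _ fun t => ?_)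
  have := young_mul_le zero_le_one (abs_nonneg (f t))
  rw [one_mul] at this
  exact this

theorem intervalIntegrable_logPsi_sub_const {f : ℝ → ℝ} (hf : MemLPsi logPsi f) (r a b : ℝ) :
    IntervalIntegrable (fun t => logPsi |f t - r|) volume a b := by
  refine IntervalIntegrable.mono_fun'
    (((intervalIntegrable_logPsi_of_memLPsi hf a b).const_mul 4).add
      (intervalIntegrable_const (c := 4 * logPsi |-r|))) ?_ (ae_of_all _ fun t => ?_)
  · exact (continuous_logPsi.comp continuous_abs).comp_aestronglyMeasurable
      (hf.aemeasurable.sub_const r).aestronglyMeasurable.restrict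
  · beta_reduce
    rw [Real.norm_of_nonneg (logPsi_nonneg _), sub_eq_add_neg]
    exact logPsi_abs_add_le (f t) (-r)

theorem intervalIntegrable_comp_const_add {h : ℝ → ℝ}
    (hh : ∀ a b, IntervalIntegrable h volume a b) (x a b : ℝ) :
    IntervalIntegrable (fun t => h (x + t)) volume a b := by
  simpa using (hh (x + a) (x + b)).comp_add_left x

theorem intervalIntegrable_comp_const_sub {h : ℝ → ℝ}
    (hh : ∀ a b, IntervalIntegrable h volume a b) (x a b : ℝ) :
    IntervalIntegrable (fun t => h (x - t)) volume a b := by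
  simpa using (hh (x - a) (x - b)).comp_sub_left x

theorem intervalIntegrable_symmDiff₂ {f : ℝ → ℝ} (hf : MemLPsi logPsi f) (x a b : ℝ) :
    IntervalIntegrable (symmDiff₂ f x) volume a b :=
  ((intervalIntegrable_comp_const_add (intervalIntegrable_of_memLPsi hf) x a b).add
    (intervalIntegrable_comp_const_sub (intervalIntegrable_of_memLPsi hf) x a b)).sub
    intervalIntegrable_const

theorem logPsi_symmDiff₂_le (f : ℝ → ℝ) (x r t : ℝ) :
    logPsi |symmDiff₂ f x t| ≤ 4 * logPsi |f (x + t) - r| + 16 * logPsi |f (x - t) - r| +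
      16 * logPsi |2 * (r - f x)| := by
  have h1 : symmDiff₂ f x t = (f (x + t) - r) + ((f (x - t) - r) + 2 * (r - f x)) := by
    unfold symmDiff₂; ring
  have h2 := logPsi_abs_add_le (f (x + t) - r) ((f (x - t) - r) + 2 * (r - f x))
  have h3 := logPsi_abs_add_le (f (x - t) - r) (2 * (r - f x))
  rw [h1]
  linarith

theorem intervalIntegrable_logPsi_symmDiff₂ {f : ℝ → ℝ} (hf : MemLPsi logPsi f) (x a b : ℝ) :
    IntervalIntegrable (fun t => logPsi |symmDiff₂ f x t|) volume a b := by
  refine IntervalIntegrable.mono_fun'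
    ((((intervalIntegrable_comp_const_add
      (intervalIntegrable_logPsi_sub_const hf 0) x a b).const_mul 4).add
      ((intervalIntegrable_comp_const_sub
        (intervalIntegrable_logPsi_sub_const hf 0) x a b).const_mul 16)).add
      (intervalIntegrable_const (c := 16 * logPsi |2 * (0 - f x)|))) ?_ (ae_of_all _ fun t => ?_)
  · exact (continuous_logPsi.comp continuous_abs).comp_aestronglyMeasurable
      (intervalIntegrable_symmDiff₂ hf x a b).aestronglyMeasurable_restrict_uIoc
  · beta_reduce
    rw [Real.norm_of_nonneg (logPsi_nonneg _)]
    exact logPsi_symmDiff₂_le f x 0 t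

/-! ### Integral representation of the partial sums. -/

theorem partialSum_eq_integral {f : ℝ → ℝ} (hf : ∀ a b, IntervalIntegrable f volume a b)
    (ν : ℕ) (x : ℝ) :
    partialSum f ν x = 1 / π * ∫ u in (-π)..π, f u * dirichletKernel ν (u - x) := by
  induction ν with
  | zero =>
    simp [partialSum, cosCoeff, dirichletKernel]
    ring
  | succ n ih =>
    have h1 : partialSum f (n + 1) x = partialSum f n x +
        (cosCoeff f (n + 1) * Real.cos ((n + 1 : ℕ) * x) +
          sinCoeff f (n + 1) * Real.sin ((n + 1 : ℕ) * x)) := by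
      unfold partialSum
      rw [Finset.sum_Icc_succ_top (by omega)]
      ring
    have h2 : ∀ u, f u * dirichletKernel (n + 1) (u - x) = f u * dirichletKernel n (u - x) +
        (f u * Real.cos ((n + 1 : ℕ) * u) * Real.cos ((n + 1 : ℕ) * x) +
          f u * Real.sin ((n + 1 : ℕ) * u) * Real.sin ((n + 1 : ℕ) * x)) := by
      intro u
      rw [dirichletKernel_succ, mul_sub, Real.cos_sub]
      push_cast
      ring
    have hD : Continuous fun u => dirichletKernel n (u - x) :=
      (continuous_dirichletKernel n).comp (by fun_prop)
    have hc : IntervalIntegrable (fun u => f u * Real.cos ((n + 1 : ℕ) * u)) volume (-π) π :=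
      (hf _ _).mul_continuousOn (by fun_prop)
    have hs : IntervalIntegrable (fun u => f u * Real.sin ((n + 1 : ℕ) * u)) volume (-π) π :=
      (hf _ _).mul_continuousOn (by fun_prop)
    rw [h1, ih]
    simp only [h2]
    rw [intervalIntegral.integral_add ((hf _ _).mul_continuousOn hD.continuousOn)
      ((hc.mul_const _).add (hs.mul_const _)),
      intervalIntegral.integral_add (hc.mul_const _) (hs.mul_const _),
      intervalIntegral.integral_mul_const, intervalIntegral.integral_mul_const]
    unfold cosCoeff sinCoeff
    ring

theorem dirichletKernel_periodic (ν : ℕ) : Function.Periodic (dirichletKernel ν) (2 * π) := by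
  intro t
  unfold dirichletKernel
  congr 1
  refine Finset.sum_congr rfl fun k _ => ?_
  rw [mul_add, Real.cos_add_nat_mul_two_pi]

theorem partialSum_sub_eq_integral {f : ℝ → ℝ} (hper : Function.Periodic f (2 * π))
    (hf : ∀ a b, IntervalIntegrable f volume a b) (ν : ℕ) (x : ℝ) :
    partialSum f ν x - f x =
      1 / π * ∫ t in (0 : ℝ)..π, symmDiff₂ f x t * dirichletKernel ν t := by
  have hDc := continuous_dirichletKernel ν
  have hA : ∀ a b, IntervalIntegrable (fun t => f (x + t) * dirichletKernel ν t) volume a b :=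
    fun a b => (intervalIntegrable_comp_const_add hf x a b).mul_continuousOn hDc.continuousOn
  have hB : ∀ a b, IntervalIntegrable (fun t => f (x - t) * dirichletKernel ν t) volume a b :=
    fun a b => (intervalIntegrable_comp_const_sub hf x a b).mul_continuousOn hDc.continuousOn
  have h1 : ∫ u in (-π)..π, f u * dirichletKernel ν (u - x) =
      ∫ t in (-π)..π, f (x + t) * dirichletKernel ν t := by
    have hp : Function.Periodic (fun t => f (x + t) * dirichletKernel ν t) (2 * π) := fun t => by
      simp only [dirichletKernel_periodic ν t, ← add_assoc, hper (x + t)]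
    have h2 := hp.intervalIntegral_add_eq (-π - x) (-π)
    rw [show -π - x + 2 * π = π - x by ring, show -π + 2 * π = π by ring] at h2
    rw [← h2]
    have h3 := intervalIntegral.integral_comp_sub_right
      (fun t => f (x + t) * dirichletKernel ν t) x (a := -π) (b := π)
    rw [← h3]
    simp
  have h4 : ∫ t in (-π)..π, f (x + t) * dirichletKernel ν t =
      (∫ t in (0 : ℝ)..π, f (x - t) * dirichletKernel ν t) +
        ∫ t in (0 : ℝ)..π, f (x + t) * dirichletKernel ν t := by
    rw [← intervalIntegral.integral_add_adjacent_intervals (hA (-π) 0) (hA 0 π)]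
    congr 1
    have h5 := intervalIntegral.integral_comp_neg
      (fun t => f (x + t) * dirichletKernel ν t) (a := 0) (b := π)
    rw [neg_zero] at h5
    rw [← h5]
    simp only [dirichletKernel_neg, sub_eq_add_neg]
  have h6 : ∫ t in (0 : ℝ)..π, symmDiff₂ f x t * dirichletKernel ν t =
      (∫ t in (0 : ℝ)..π, f (x - t) * dirichletKernel ν t) +
        (∫ t in (0 : ℝ)..π, f (x + t) * dirichletKernel ν t) - 2 * f x * (π / 2) := by
    rw [← integral_dirichletKernel ν, ← intervalIntegral.integral_const_mul,
      ← intervalIntegral.integral_add (hB 0 π) (hA 0 π), ← intervalIntegral.integral_sub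
        ((hB 0 π).add (hA 0 π)) ((hDc.intervalIntegrable _ _).const_mul _)]
    congr 1
    ext t
    unfold symmDiff₂
    ring
  rw [partialSum_eq_integral hf, h1, h4, h6]
  field_simp

/-! ### Riemann–Lebesgue and the part of the integral away from 0. -/

theorem tendsto_integral_mul_sin {G : ℝ → ℝ} (hG : Integrable G) :
    Tendsto (fun ν : ℕ => ∫ t, G t * Real.sin (((ν : ℝ) + 1 / 2) * t)) atTop (𝓝 0) := by
  -- The division by 2π matches the normalisation of `Real.fourierChar`; the sine is then minus the
  -- imaginary part of the exponential.
  have hw : Tendsto (fun ν : ℕ => ((ν : ℝ) + 1 / 2) / (2 * π)) atTop (cocompact ℝ) := by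
    refine Tendsto.mono_right ?_ atTop_le_cocompact
    exact (tendsto_atTop_add_const_right _ _ tendsto_natCast_atTop_atTop).atTop_div_const
      (by positivity)
  have h1 := (Real.tendsto_integral_exp_smul_cocompact (fun t => (G t : ℂ))).comp hw
  have h2 := (Complex.continuous_im.tendsto _).comp h1
  rw [Complex.zero_im] at h2
  have h3 := h2.neg
  rw [neg_zero] at h3
  refine h3.congr fun ν => ?_
  simp only [Function.comp_apply]
  have hpt : ∀ v : ℝ, (Real.fourierChar (-(v * (((ν : ℝ) + 1 / 2) / (2 * π)))) • (G v : ℂ)) =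
      Complex.exp ((-(((ν : ℝ) + 1 / 2) * v) : ℝ) * Complex.I) * (G v : ℂ) := by
    intro v
    rw [Circle.smul_def, Real.fourierChar_apply, smul_eq_mul]
    congr 4
    field_simp
  have hint : Integrable fun v : ℝ =>
      Complex.exp ((-(((ν : ℝ) + 1 / 2) * v) : ℝ) * Complex.I) * (G v : ℂ) := by
    refine hG.ofReal.bdd_mul (c := 1) (Continuous.aestronglyMeasurable (by fun_prop))
      (ae_of_all _ fun v => ?_)
    rw [Complex.norm_exp_ofReal_mul_I]
  simp only [hpt]
  have h4 := integral_im hint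
  simp only [RCLike.im_to_complex] at h4
  rw [← h4, ← integral_neg]
  congr 1
  ext v
  rw [Complex.im_mul_ofReal, Complex.exp_ofReal_mul_I_im, Real.sin_neg]
  ring

theorem tendsto_integral_indicator_mul_dirichletKernel {φ : ℝ → ℝ}
    (hφ : ∀ a b, IntervalIntegrable φ volume a b) {δ : ℝ} (hδ : 0 < δ) (hδπ : δ ≤ π) :
    Tendsto (fun ν : ℕ => ∫ t in (0 : ℝ)..π, (Set.Ioi δ).indicator φ t * dirichletKernel ν t)
      atTop (𝓝 0) := by
  have hs : ∀ t ∈ Set.Icc δ π, 0 < Real.sin (t / 2) := fun t ht =>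
    Real.sin_pos_of_pos_of_lt_pi (by linarith [ht.1]) (by linarith [ht.2, Real.pi_pos])
  set G : ℝ → ℝ := (Set.Ioc δ π).indicator fun t => φ t * (2 * Real.sin (t / 2))⁻¹ with hG
  have hGi : Integrable G := by
    rw [hG, integrable_indicator_iff measurableSet_Ioc,
      ← intervalIntegrable_iff_integrableOn_Ioc_of_le hδπ]
    refine (hφ _ _).mul_continuousOn (ContinuousOn.inv₀ (by fun_prop) fun t ht => ?_)
    rw [Set.uIcc_of_le hδπ] at ht
    have := hs t ht
    positivity
  refine (tendsto_integral_mul_sin hGi).congr fun ν => ?_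
  rw [intervalIntegral.integral_of_le Real.pi_pos.le, ← integral_indicator measurableSet_Ioc]
  congr 1
  ext t
  by_cases h1 : t ∈ Set.Ioc δ π
  · have h2 : t ∈ Set.Ioc 0 π := ⟨hδ.trans h1.1, h1.2⟩
    have h3 := hs t ⟨h1.1.le, h1.2⟩
    rw [hG, Set.indicator_of_mem h1, Set.indicator_of_mem h2,
      Set.indicator_of_mem (show t ∈ Set.Ioi δ from h1.1), ← two_sin_mul_dirichletKernel]
    field_simp
  · rw [hG, Set.indicator_of_notMem h1, zero_mul]
    by_cases h2 : t ∈ Set.Ioc 0 π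
    · rw [Set.indicator_of_mem h2, Set.indicator_of_notMem, zero_mul]
      exact fun h3 => h1 ⟨h3, h2.2⟩
    · rw [Set.indicator_of_notMem h2]

/-! ### L^Ψ-points. -/

theorem logPsi_pos {x : ℝ} (hx : 0 < x) : 0 < logPsi x := by
  have h1 := mul_log_le_logPsi hx.le
  have h2 : 0 < Real.log (1 + x) := Real.log_pos (by linarith)
  have : 0 < x * Real.log (1 + x) / 4 := by positivity
  linarith

theorem tendsto_nInv_logPsi {u : ℕ → ℝ} (hu : ∀ n, 0 ≤ u n)
    (h : Tendsto u atTop (𝓝 0)) : Tendsto (fun n => nInv logPsi (u n)) atTop (𝓝 0) := by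
  rw [Metric.tendsto_nhds]
  intro ε hε
  filter_upwards [h.eventually_lt_const (logPsi_pos hε)] with n hn
  obtain ⟨h1, h2⟩ := nInv_logPsi (hu n)
  rw [Real.dist_eq, sub_zero, abs_of_nonneg h1]
  by_contra! hc
  have := logPsi_mono hε.le hc
  linarith

theorem integral_logPsi_symmDiff₂_nonneg (f : ℝ → ℝ) (x : ℝ) {u : ℝ} (hu : 0 ≤ u) :
    0 ≤ ∫ t in (0 : ℝ)..u, logPsi |symmDiff₂ f x t| :=
  intervalIntegral.integral_nonneg_of_forall hu fun _ => logPsi_nonneg _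

theorem logPsi_pointModulus (f : ℝ → ℝ) (x : ℝ) {u : ℝ} (hu : 0 ≤ u) :
    logPsi (pointModulus logPsi f x u) =
      1 / u * ∫ t in (0 : ℝ)..u, logPsi |symmDiff₂ f x t| :=
  (nInv_logPsi (mul_nonneg (by positivity) (integral_logPsi_symmDiff₂_nonneg f x hu))).2

theorem integral_logPsi_symmDiff₂_mono {f : ℝ → ℝ} (hf : MemLPsi logPsi f) (x : ℝ) {u v : ℝ}
    (hu : 0 ≤ u) (huv : u ≤ v) : ∫ t in (0 : ℝ)..u, logPsi |symmDiff₂ f x t| ≤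
      ∫ t in (0 : ℝ)..v, logPsi |symmDiff₂ f x t| :=
  intervalIntegral.integral_mono_interval le_rfl hu huv (ae_of_all _ fun _ => logPsi_nonneg _)
    (intervalIntegrable_logPsi_symmDiff₂ hf x _ _)

/-- Passage from the radii π/(n+1) to all small u: with n + 1 = ⌊π/u⌋ one has u ≤ π/(n+1) ≤ 2u, and
monotonicity of the integral costs a factor 2, absorbed by starting from ε/2. -/
theorem IsLPsiPoint.exists_integral_le {f : ℝ → ℝ} (hf : MemLPsi logPsi f) {x : ℝ}
    (hx : IsLPsiPoint logPsi f x) {ε : ℝ} (hε : 0 < ε) :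
    ∃ δ, 0 < δ ∧ δ ≤ π ∧ ∀ u, 0 ≤ u → u ≤ δ →
      ∫ t in (0 : ℝ)..u, logPsi |symmDiff₂ f x t| ≤ ε * u := by
  have h1 := (continuous_logPsi.tendsto 0).comp hx
  rw [logPsi_zero] at h1
  obtain ⟨n₀, hn₀⟩ := eventually_atTop.1 (h1.eventually_lt_const (half_pos hε))
  refine ⟨π / ((n₀ : ℝ) + 1), by positivity, div_le_self Real.pi_pos.le
    (by have := Nat.cast_nonneg (α := ℝ) n₀; linarith), fun u hu huδ => ?_⟩
  rcases hu.eq_or_lt with rfl | hu0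
  · simp
  have h2 : (n₀ : ℝ) + 1 ≤ π / u := by
    rw [le_div_iff₀ (by positivity)] at huδ
    rw [le_div_iff₀ hu0]
    linarith
  have h3 : n₀ + 1 ≤ ⌊π / u⌋₊ := Nat.le_floor (by push_cast; exact h2)
  obtain ⟨n, hn⟩ : ∃ n, ⌊π / u⌋₊ = n + 1 := ⟨⌊π / u⌋₊ - 1, by omega⟩
  have h4 : (n : ℝ) + 1 ≤ π / u := by
    have := Nat.floor_le (show 0 ≤ π / u by positivity)
    rw [hn] at this; push_cast at this; exact this
  have h5 : π / u < (n : ℝ) + 2 := by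
    have := Nat.lt_floor_add_one (π / u)
    rw [hn] at this; push_cast at this; linarith
  have h6 : u ≤ π / ((n : ℝ) + 1) := by
    rw [le_div_iff₀ hu0] at h4
    rw [le_div_iff₀ (by positivity)]
    linarith
  have h7 := hn₀ n (by omega)
  simp only [Function.comp_apply] at h7
  rw [logPsi_pointModulus f x (by positivity), one_div_div] at h7
  have h8 : ∫ t in (0 : ℝ)..(π / ((n : ℝ) + 1)), logPsi |symmDiff₂ f x t| ≤
      ε / 2 * (π / ((n : ℝ) + 1)) := by
    have h9 := mul_le_mul_of_nonneg_right h7.le (show 0 ≤ π / ((n : ℝ) + 1) by positivity)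
    refine le_trans (le_of_eq ?_) h9
    field_simp
  have h10 : π / ((n : ℝ) + 1) ≤ 2 * u := by
    rw [div_lt_iff₀ hu0] at h5
    rw [div_le_iff₀ (by positivity)]
    have := Nat.cast_nonneg (α := ℝ) n
    nlinarith
  calc _ ≤ _ := integral_logPsi_symmDiff₂_mono hf x hu h6
    _ ≤ _ := h8
    _ ≤ ε / 2 * (2 * u) := by gcongr
    _ = ε * u := by ring

/-! ### Convergence of the characteristic. -/

theorem tendsto_characteristic {f : ℝ → ℝ} (hf : MemLPsi logPsi f) {x : ℝ}
    (hx : IsLPsiPoint logPsi f x) :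
    Tendsto (fun n : ℕ => characteristic logPsi f n x) atTop (𝓝 0) := by
  set e : ℝ → ℝ := fun u => logPsi (pointModulus logPsi f x u) with he
  have hle : ∀ k : ℕ, deriv logPsi (1 / ((k : ℝ) + 1)) ≤ ((k : ℝ) + 1)⁻¹ ∧
      0 ≤ deriv logPsi (1 / ((k : ℝ) + 1)) := by
    intro k
    have h0 : 0 < 1 / ((k : ℝ) + 1) := by positivity
    rw [deriv_logPsi h0]
    refine ⟨?_, Real.log_nonneg (by linarith)⟩
    have := Real.log_le_sub_one_of_pos (show 0 < 1 + 1 / ((k : ℝ) + 1) by positivity)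
    rw [one_div] at this ⊢
    linarith
  have hw : ∀ k : ℕ, deriv logPsi (1 / ((k : ℝ) + 1)) / Real.sqrt ((k : ℝ) + 1) ≤
      ((k : ℝ) + 1) ^ (-(1 + 1 / 2) : ℝ) := by
    intro k
    have hk : (0 : ℝ) < (k : ℝ) + 1 := by positivity
    rw [neg_add, Real.rpow_add hk, Real.rpow_neg_one, Real.rpow_neg hk.le, ← Real.sqrt_eq_rpow,
      div_eq_mul_inv]
    gcongr
    exact (hle k).1
  have hw0 : ∀ k : ℕ, 0 ≤ deriv logPsi (1 / ((k : ℝ) + 1)) / Real.sqrt ((k : ℝ) + 1) :=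
    fun k => div_nonneg (hle k).2 (Real.sqrt_nonneg _)
  have hsumm : Summable fun k : ℕ => ((k : ℝ) + 1) ^ (-(1 + 1 / 2) : ℝ) :=
    summable_of_sum_range_le (fun k => by positivity)
      fun N => sum_rpow_le (show (0 : ℝ) < 1 / 2 by norm_num) N
  have he0 : ∀ u, 0 ≤ e u := fun u => logPsi_nonneg _
  obtain ⟨δ₁, hδ₁, hδ₁π, hδ₁b⟩ := hx.exists_integral_le hf one_pos
  set M := 1 + 1 / δ₁ * ∫ t in (0 : ℝ)..π, logPsi |symmDiff₂ f x t| with hM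
  have hIπ := integral_logPsi_symmDiff₂_nonneg f x Real.pi_pos.le
  have hM0 : 0 ≤ M := by positivity
  have heM : ∀ u, 0 < u → u ≤ π → e u ≤ M := by
    intro u hu huπ
    simp only [he]
    rw [logPsi_pointModulus f x hu.le]
    rcases le_total u δ₁ with h | h
    · have h1 : 1 / u * ∫ t in (0 : ℝ)..u, logPsi |symmDiff₂ f x t| ≤ 1 := by
        calc _ ≤ 1 / u * (1 * u) := by gcongr; exact hδ₁b u hu.le h
          _ = 1 := by field_simp
      have : 0 ≤ 1 / δ₁ * ∫ t in (0 : ℝ)..π, logPsi |symmDiff₂ f x t| := by positivity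
      linarith
    · have h1 : 1 / u * ∫ t in (0 : ℝ)..u, logPsi |symmDiff₂ f x t| ≤
          1 / δ₁ * ∫ t in (0 : ℝ)..π, logPsi |symmDiff₂ f x t| :=
        mul_le_mul (one_div_le_one_div_of_le hδ₁ h) (integral_logPsi_symmDiff₂_mono hf x hu.le huπ)
          (integral_logPsi_symmDiff₂_nonneg f x hu.le) (by positivity)
      linarith
  have hlim : ∀ k : ℕ, Tendsto (fun n : ℕ => e (π * ((k : ℝ) + 1) / ((n : ℝ) + 1))) atTop (𝓝 0) := by
    intro k
    have hto : Tendsto (fun n : ℕ => π * ((k : ℝ) + 1) / ((n : ℝ) + 1)) atTop (𝓝 0) :=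
      tendsto_const_nhds.div_atTop (tendsto_atTop_add_const_right _ _ tendsto_natCast_atTop_atTop)
    rw [Metric.tendsto_nhds]
    intro ε hε
    obtain ⟨δ, hδ, -, hδb⟩ := hx.exists_integral_le hf (half_pos hε)
    filter_upwards [hto.eventually_lt_const hδ] with n hn
    have hu : 0 < π * ((k : ℝ) + 1) / ((n : ℝ) + 1) := by positivity
    rw [Real.dist_eq, sub_zero, abs_of_nonneg (he0 _)]
    simp only [he]
    rw [logPsi_pointModulus f x hu.le]
    set u := π * ((k : ℝ) + 1) / ((n : ℝ) + 1)
    calc _ ≤ 1 / u * (ε / 2 * u) := by gcongr; exact hδb u hu.le hn.le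
      _ = ε / 2 := by field_simp
      _ < ε := half_lt_self hε
  have hfirst : Tendsto (fun n : ℕ => ∑ k ∈ Finset.range (n + 1),
      deriv logPsi (1 / ((k : ℝ) + 1)) / Real.sqrt ((k : ℝ) + 1) *
        e (π * ((k : ℝ) + 1) / ((n : ℝ) + 1))) atTop (𝓝 0) := by
    -- Extending the sum by zeros turns it into a series dominated by M(k+1)^{-3/2}, each of whose
    -- terms tends to 0 for fixed k.
    set F : ℕ → ℕ → ℝ := fun n k => if k ∈ Finset.range (n + 1) then
      deriv logPsi (1 / ((k : ℝ) + 1)) / Real.sqrt ((k : ℝ) + 1) *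
        e (π * ((k : ℝ) + 1) / ((n : ℝ) + 1)) else 0 with hF
    have h := tendsto_tsum_of_dominated_convergence (𝓕 := atTop) (f := F) (g := fun _ => 0)
      (hsumm.mul_right M) (fun k => ?_) (Eventually.of_forall fun n k => ?_)
    · rw [tsum_zero] at h
      refine h.congr fun n => ?_
      rw [tsum_eq_sum (s := Finset.range (n + 1)) fun k hk => by simp only [hF, if_neg hk]]
      exact Finset.sum_congr rfl fun k hk => by simp only [hF, if_pos hk]
    · have h1 := (hlim k).const_mul
        (deriv logPsi (1 / ((k : ℝ) + 1)) / Real.sqrt ((k : ℝ) + 1))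
      rw [mul_zero] at h1
      refine h1.congr' ?_
      filter_upwards [eventually_ge_atTop k] with n hn
      simp only [hF]
      rw [if_pos (Finset.mem_range.2 (by omega))]
    · simp only [hF]
      split_ifs with hk
      · rw [Real.norm_of_nonneg (mul_nonneg (hw0 k) (he0 _))]
        have hkn : (k : ℝ) + 1 ≤ (n : ℝ) + 1 := by
          exact_mod_cast Nat.lt_succ_iff.1 (by have := Finset.mem_range.1 hk; omega)
        refine mul_le_mul (hw k) (heM _ (by positivity) ?_) (he0 _) (by positivity)
        rw [div_le_iff₀ (by positivity)]
        gcongr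
      · rw [norm_zero]
        positivity
  have hsecond : Tendsto (fun n : ℕ => ((n : ℝ) + 1) * logPsi (1 / ((n : ℝ) + 1)) * e π)
      atTop (𝓝 0) := by
    have h1 : Tendsto (fun n : ℕ => ((n : ℝ) + 1) * logPsi (1 / ((n : ℝ) + 1))) atTop (𝓝 0) := by
      refine squeeze_zero (fun n => mul_nonneg (by positivity) (logPsi_nonneg _)) (fun n => ?_)
        tendsto_one_div_add_atTop_nhds_zero_nat
      calc ((n : ℝ) + 1) * logPsi (1 / ((n : ℝ) + 1))
          ≤ ((n : ℝ) + 1) * (1 / ((n : ℝ) + 1)) ^ 2 := by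
            gcongr; exact logPsi_le_sq (by positivity)
        _ = 1 / ((n : ℝ) + 1) := by field_simp
    simpa using h1.mul_const (e π)
  have := hfirst.add hsecond
  rw [add_zero] at this
  exact this

/-! ### Convergence of the strong means. -/

theorem tendsto_strongMean {f : ℝ → ℝ} (hf : MemLPsi logPsi f) {x : ℝ}
    (hx : IsLPsiPoint logPsi f x) :
    Tendsto (fun n : ℕ => strongMean expPhi f n x) atTop (𝓝 0) := by
  refine tendsto_nInv_expPhi (fun n => mul_nonneg (by positivity)
    (Finset.sum_nonneg fun _ _ => expPhi_nonneg _)) ?_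
  set φ := symmDiff₂ f x with hφdef
  have hφ := intervalIntegrable_symmDiff₂ hf x
  have hψ := intervalIntegrable_logPsi_symmDiff₂ hf x
  rw [Metric.tendsto_nhds]
  intro ε hε
  set τ := min (1 / 6) (ε / 40) / (3120 * 80) with hτdef
  have hτ0 : 0 < τ := by positivity
  have hτ' : 3120 * 80 * τ = min (1 / 6) (ε / 40) := by rw [hτdef]; ring
  have hτ1 : 3120 * 80 * τ ≤ 1 / 6 := hτ'.trans_le (min_le_left _ _)
  have hτ2 : 40 * (3120 * 80 * τ) ≤ ε := by
    have := hτ'.trans_le (min_le_right _ _); linarith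
  obtain ⟨δ, hδ, hδπ, hδb⟩ := hx.exists_integral_le hf (show 0 < τ ^ 2 by positivity)
  set φ₁ := (Set.Iic δ).indicator φ with hφ₁
  set φ₂ := (Set.Ioi δ).indicator φ with hφ₂
  have hφ₁i : ∀ a b, IntervalIntegrable φ₁ volume a b := fun a b => by
    rw [intervalIntegrable_iff]
    exact ((intervalIntegrable_iff.1 (hφ a b))).indicator measurableSet_Iic
  have hφ₂i : ∀ a b, IntervalIntegrable φ₂ volume a b := fun a b => by
    rw [intervalIntegrable_iff]
    exact ((intervalIntegrable_iff.1 (hφ a b))).indicator measurableSet_Ioi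
  have hψ₁ : (fun t => logPsi |φ₁ t|) = (Set.Iic δ).indicator fun t => logPsi |φ t| := by
    ext t
    by_cases ht : t ∈ Set.Iic δ
    · rw [hφ₁, Set.indicator_of_mem ht, Set.indicator_of_mem ht]
    · rw [hφ₁, Set.indicator_of_notMem ht, Set.indicator_of_notMem ht, abs_zero, logPsi_zero]
  have hψ₁i : ∀ a b, IntervalIntegrable (fun t => logPsi |φ₁ t|) volume a b := fun a b => by
    rw [hψ₁, intervalIntegrable_iff]
    exact ((intervalIntegrable_iff.1 (hψ a b))).indicator measurableSet_Iic
  have hshort : ∀ u, 0 ≤ u → u ≤ δ → ∫ t in (0 : ℝ)..u, logPsi |φ₁ t| ≤ τ ^ 2 * u := by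
    intro u hu huδ
    refine le_trans (le_of_eq ?_) (hδb u hu huδ)
    refine intervalIntegral.integral_congr fun t ht => ?_
    rw [Set.uIcc_of_le hu] at ht
    simp only [hφ₁]
    rw [Set.indicator_of_mem (show t ∈ Set.Iic δ from ht.2.trans huδ)]
  have hnear : ∀ u, 0 ≤ u → ∫ t in (0 : ℝ)..u, logPsi |φ₁ t| ≤ τ ^ 2 * u := by
    intro u hu
    rcases le_total u δ with h | h
    · exact hshort u hu h
    · rw [← intervalIntegral.integral_add_adjacent_intervals (hψ₁i 0 δ) (hψ₁i δ u)]
      have h0 : ∫ t in δ..u, logPsi |φ₁ t| = 0 := by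
        rw [intervalIntegral.integral_of_le h]
        refine setIntegral_eq_zero_of_forall_eq_zero fun t ht => ?_
        rw [hφ₁, Set.indicator_of_notMem (show t ∉ Set.Iic δ from not_le.2 ht.1), abs_zero,
          logPsi_zero]
      rw [h0, add_zero]
      exact (hshort δ hδ.le le_rfl).trans (by gcongr)
  set A₁ : ℕ → ℝ := fun ν => ∫ t in (0 : ℝ)..π, φ₁ t * dirichletKernel ν t with hA₁
  set A₂ : ℕ → ℝ := fun ν => ∫ t in (0 : ℝ)..π, φ₂ t * dirichletKernel ν t with hA₂
  have hsplit : ∀ ν, partialSum f ν x - f x = 1 / π * (A₁ ν + A₂ ν) := by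
    intro ν
    have hD := (continuous_dirichletKernel ν).continuousOn (s := Set.uIcc 0 π)
    rw [partialSum_sub_eq_integral hf.periodic (intervalIntegrable_of_memLPsi hf), hA₁, hA₂,
      ← intervalIntegral.integral_add ((hφ₁i _ _).mul_continuousOn hD)
        ((hφ₂i _ _).mul_continuousOn hD)]
    congr 2
    ext t
    rw [← add_mul, hφ₁, hφ₂, ← Set.compl_Iic]
    congr 1
    exact (congrFun (Set.indicator_self_add_compl (Set.Iic δ) φ) t).symm
  have hbound : ∀ ν, expPhi |partialSum f ν x - f x| ≤ expPhi |A₁ ν| / 2 + expPhi |A₂ ν| / 2 := by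
    intro ν
    -- The prefactor 1/π ≤ 1/2 exactly absorbs the doubling of arguments in the convexity bound
    -- `expPhi_add_le`.
    have hπ : 1 / π ≤ 1 / 2 := one_div_le_one_div_of_le (by norm_num) Real.two_le_pi
    have h1 : |partialSum f ν x - f x| ≤ |A₁ ν| / 2 + |A₂ ν| / 2 := by
      rw [hsplit, abs_mul, abs_of_pos (show 0 < 1 / π by positivity)]
      calc 1 / π * |A₁ ν + A₂ ν| ≤ 1 / 2 * (|A₁ ν| + |A₂ ν|) := by
            gcongr; exact abs_add_le _ _
        _ = _ := by ring
    refine (expPhi_mono (abs_nonneg _) h1).trans ?_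
    refine (expPhi_add_le (by positivity) (by positivity)).trans (le_of_eq ?_)
    rw [mul_div_cancel₀ _ two_ne_zero, mul_div_cancel₀ _ two_ne_zero]
  have hA₂lim : Tendsto (fun ν => expPhi |A₂ ν|) atTop (𝓝 0) := by
    have h1 := ((continuous_expPhi.comp continuous_abs).tendsto 0).comp
      (tendsto_integral_indicator_mul_dirichletKernel hφ hδ hδπ)
    simp only [Function.comp_apply, abs_zero, expPhi_zero] at h1
    exact h1
  have hces := (hA₂lim.cesaro).comp (tendsto_add_atTop_nat 1)
  filter_upwards [hces.eventually_lt_const hε] with n hn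
  simp only [Function.comp_apply] at hn
  have hn1 : (0 : ℝ) < (n : ℝ) + 1 := by positivity
  rw [Real.dist_eq, sub_zero, abs_of_nonneg (mul_nonneg (by positivity)
    (Finset.sum_nonneg fun _ _ => expPhi_nonneg _))]
  have hmain := sum_expPhi_integral_le hφ₁i hψ₁i hτ0 hτ1 hnear (Nat.succ_pos n)
  push_cast at hn hmain
  calc 1 / ((n : ℝ) + 1) * ∑ ν ∈ Finset.range (n + 1), expPhi |partialSum f ν x - f x|
      ≤ 1 / ((n : ℝ) + 1) * ∑ ν ∈ Finset.range (n + 1),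
          (expPhi |A₁ ν| / 2 + expPhi |A₂ ν| / 2) := by
        gcongr with ν _
        exact hbound ν
    _ = 1 / ((n : ℝ) + 1) * (∑ ν ∈ Finset.range (n + 1), expPhi |A₁ ν|) / 2 +
          ((n : ℝ) + 1)⁻¹ * (∑ ν ∈ Finset.range (n + 1), expPhi |A₂ ν|) / 2 := by
        rw [Finset.sum_add_distrib, ← Finset.sum_div, ← Finset.sum_div, one_div]
        ring
    _ ≤ 1 / ((n : ℝ) + 1) * (((n : ℝ) + 1) * ε) / 2 +
          ((n : ℝ) + 1)⁻¹ * (∑ ν ∈ Finset.range (n + 1), expPhi |A₂ ν|) / 2 := by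
        gcongr
        refine hmain.trans ?_
        gcongr
    _ = ε / 2 + ((n : ℝ) + 1)⁻¹ * (∑ ν ∈ Finset.range (n + 1), expPhi |A₂ ν|) / 2 := by
        field_simp
    _ < ε := by linarith

/-! ### Almost every point is an L^Ψ-point. -/

theorem ae_isLPsiPoint {f : ℝ → ℝ} (hf : MemLPsi logPsi f) :
    ∀ᵐ x ∂(volume : Measure ℝ), IsLPsiPoint logPsi f x := by
  have hloc : ∀ r : ℝ, LocallyIntegrable (fun t => logPsi |f t - r|) volume := by
    intro r
    rw [locallyIntegrable_iff]
    intro K hK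
    obtain ⟨a, ha⟩ := hK.bddBelow
    obtain ⟨b, hb⟩ := hK.bddAbove
    have hab : K ⊆ Set.Icc a b := fun t ht => ⟨ha ht, hb ht⟩
    have h := intervalIntegrable_logPsi_sub_const hf r (min a b) (max a b)
    rw [intervalIntegrable_iff_integrableOn_Icc_of_le min_le_max] at h
    exact h.mono_set (hab.trans (Set.Icc_subset_Icc (min_le_left _ _) (le_max_right _ _)))
  -- Only rational r, so that countably many null sets are discarded. The base point c stays free
  -- because it is later taken to be x itself.
  have hae : ∀ᵐ x ∂(volume : Measure ℝ), ∀ r : ℚ, ∀ c, HasDerivAt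
      (fun y => ∫ t in c..y, logPsi |f t - r|) (logPsi |f x - r|) x :=
    ae_all_iff.2 fun r => LocallyIntegrable.ae_hasDerivAt_integral (hloc r)
  filter_upwards [hae] with x hx
  refine tendsto_nInv_logPsi (fun n => mul_nonneg (by positivity)
    (integral_logPsi_symmDiff₂_nonneg f x (by positivity))) ?_
  have hu0 : ∀ n : ℕ, 0 < π / ((n : ℝ) + 1) := fun n => by positivity
  have hto : Tendsto (fun n : ℕ => π / ((n : ℝ) + 1)) atTop (𝓝[>] 0) :=
    tendsto_nhdsWithin_iff.2 ⟨tendsto_const_nhds.div_atTop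
      (tendsto_atTop_add_const_right _ _ tendsto_natCast_atTop_atTop),
      Eventually.of_forall hu0⟩
  rw [Metric.tendsto_nhds]
  intro ε hε
  -- This quantity is the limit of the upper bound for the averages of Ψ(|φ_x|), with 20 = 4 + 16
  -- from the two one-sided averages; it vanishes at r = f(x), and density gives a rational r.
  obtain ⟨r, hr⟩ : ∃ r : ℚ,
      20 * logPsi |f x - r| + 16 * logPsi |2 * (r - f x)| < ε := by
    have hc : Continuous fun r : ℝ => 20 * logPsi |f x - r| + 16 * logPsi |2 * (r - f x)| := by
      have := continuous_logPsi
      fun_prop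
    have h1 := hc.tendsto (f x)
    simp only [sub_self, mul_zero, abs_zero, logPsi_zero, add_zero] at h1
    exact Rat.denseRange_cast.exists_mem_open (isOpen_lt hc continuous_const)
      ⟨f x, by simpa using hε⟩
  set G : ℝ → ℝ := fun y => ∫ t in x..y, logPsi |f t - r| with hG
  have hGx : G x = 0 := by simp [hG]
  have hGd : HasDerivAt G (logPsi |f x - r|) x := hx r x
  have hright : Tendsto (fun u : ℝ => 1 / u * G (x + u)) (𝓝[>] 0) (𝓝 (logPsi |f x - r|)) := by
    have h1 := hGd.tendsto_slope_zero_right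
    simpa [hGx] using h1
  have hleft : Tendsto (fun u : ℝ => 1 / u * (-G (x - u))) (𝓝[>] 0) (𝓝 (logPsi |f x - r|)) := by
    have h0 : HasDerivAt (fun u : ℝ => x - u) (-1) 0 := by
      simpa using (hasDerivAt_id (0 : ℝ)).const_sub x
    have h1 : HasDerivAt (fun u => -G (x - u)) (logPsi |f x - r|) 0 := by
      have h2 : HasDerivAt G (logPsi |f x - r|) (x - 0) := by rwa [sub_zero]
      have := (h2.comp 0 h0).fun_neg
      simpa [Function.comp_def] using this
    have h3 := h1.tendsto_slope_zero_right
    simpa [hGx] using h3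
  have hlim : Tendsto (fun u : ℝ => 4 * (1 / u * G (x + u)) + 16 * (1 / u * (-G (x - u))) +
      16 * logPsi |2 * (r - f x)|) (𝓝[>] 0)
      (𝓝 (4 * logPsi |f x - r| + 16 * logPsi |f x - r| + 16 * logPsi |2 * (r - f x)|)) :=
    ((hright.const_mul 4).add (hleft.const_mul 16)).add_const _
  have hev := (hlim.comp hto).eventually_lt_const
    (show 4 * logPsi |f x - r| + 16 * logPsi |f x - r| + 16 * logPsi |2 * (r - f x)| < ε by
      linarith)
  filter_upwards [hev] with n hn
  simp only [Function.comp_apply] at hn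
  have hun := hu0 n
  rw [Real.dist_eq, sub_zero, abs_of_nonneg (mul_nonneg (by positivity)
    (integral_logPsi_symmDiff₂_nonneg f x (by positivity)))]
  set u := π / ((n : ℝ) + 1)
  have hi := intervalIntegrable_logPsi_sub_const hf r
  have hia := intervalIntegrable_comp_const_add hi x 0 u
  have his := intervalIntegrable_comp_const_sub hi x 0 u
  have hGp : ∫ t in (0 : ℝ)..u, logPsi |f (x + t) - r| = G (x + u) := by
    simp only [hG]
    rw [intervalIntegral.integral_comp_add_left (fun t => logPsi |f t - r|), add_zero]
  have hGm : ∫ t in (0 : ℝ)..u, logPsi |f (x - t) - r| = -G (x - u) := by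
    simp only [hG]
    rw [intervalIntegral.integral_comp_sub_left (fun t => logPsi |f t - r|), sub_zero,
      intervalIntegral.integral_symm]
  have hI : ∫ t in (0 : ℝ)..u, logPsi |symmDiff₂ f x t| ≤
      4 * G (x + u) + 16 * (-G (x - u)) + u * (16 * logPsi |2 * (r - f x)|) := by
    have h1 := intervalIntegral.integral_mono_on hun.le
      (intervalIntegrable_logPsi_symmDiff₂ hf x 0 u)
      (((hia.const_mul 4).add (his.const_mul 16)).add
        (intervalIntegrable_const (c := 16 * logPsi |2 * ((r : ℝ) - f x)|)))
      fun t _ => logPsi_symmDiff₂_le f x r t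
    rw [intervalIntegral.integral_add ((hia.const_mul 4).add (his.const_mul 16))
      intervalIntegrable_const, intervalIntegral.integral_add (hia.const_mul 4)
      (his.const_mul 16), intervalIntegral.integral_const_mul,
      intervalIntegral.integral_const_mul, intervalIntegral.integral_const, hGp, hGm,
      smul_eq_mul, sub_zero] at h1
    exact h1
  calc 1 / u * ∫ t in (0 : ℝ)..u, logPsi |symmDiff₂ f x t|
      ≤ 1 / u * (4 * G (x + u) + 16 * (-G (x - u)) + u * (16 * logPsi |2 * (r - f x)|)) := by
        gcongr
    _ = 4 * (1 / u * G (x + u)) + 16 * (1 / u * (-G (x - u))) +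
          16 * logPsi |2 * (r - f x)| := by field_simp
    _ < ε := hn

end StrongApprox

theorem corollary1 (f : ℝ → ℝ) (hf : StrongApprox.MemLPsi StrongApprox.logPsi f) :
    (∀ x : ℝ, StrongApprox.IsLPsiPoint StrongApprox.logPsi f x →
        Tendsto (fun n : ℕ => StrongApprox.characteristic StrongApprox.logPsi f n x)
          atTop (𝓝 0)) ∧
      (∀ x : ℝ, StrongApprox.IsLPsiPoint StrongApprox.logPsi f x →
        Tendsto (fun n : ℕ => StrongApprox.strongMean StrongApprox.expPhi f n x)
          atTop (𝓝 0)) ∧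
      (∀ᵐ x ∂(volume : Measure ℝ), StrongApprox.IsLPsiPoint StrongApprox.logPsi f x) ∧
      (∀ᵐ x ∂(volume : Measure ℝ),
        Tendsto (fun n : ℕ => StrongApprox.characteristic StrongApprox.logPsi f n x)
          atTop (𝓝 0)) ∧
      (∀ᵐ x ∂(volume : Measure ℝ),
        Tendsto (fun n : ℕ => StrongApprox.strongMean StrongApprox.expPhi f n x)
          atTop (𝓝 0)) :=
  ⟨fun _ hx => StrongApprox.tendsto_characteristic hf hx,
    fun _ hx => StrongApprox.tendsto_strongMean hf hx,
    StrongApprox.ae_isLPsiPoint hf,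
    (StrongApprox.ae_isLPsiPoint hf).mono fun _ hx => StrongApprox.tendsto_characteristic hf hx,
    (StrongApprox.ae_isLPsiPoint hf).mono fun _ hx => StrongApprox.tendsto_strongMean hf hx⟩
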